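/- **Theorem 5.11 (integer and fractional Hardy–Sobolev inequalities in Morrey spaces on $\mathbb{R}^N$).** Let $|\cdot|$ be the Euclidean norm on $\mathbb{R}^N$. For $p>0$ and $\lambda\in\mathbb{R}$ put $$\|f\|_{M^\lambda_p}:=\Big(\sup_{x\in\mathbb{R}^N}\sup_{r>0} r^{-\lambda}\int_{B(x,r)}|f(y)|^p\,dy\Big)^{1/p}\in[0,\infty],$$ and let $M^\lambda_p=M^\lambda_p(\mathbb{R}^N)$ be the space of measurable $f$ with $\|f\|_{M^\lambda_p}<\infty$. For $\gamma>0$ say that real numbers $\alpha,\beta,p,q,\lambda$ are admissible of order $\gamma$ if $$0\le\alpha+\beta\le\gamma<N,\qquad 1<p<\frac{N}{\gamma-\alpha-\beta},\qquad \frac1q=\frac1p-\frac{\gamma-\alpha-\beta}{N-\lambda},$$ $$\alpha<\frac{N}{p'},\qquad \beta<\frac{N-\lambda}{q},\qquad 0<\lambda<\min\{N-\beta p,\;N-(\gamma-\alpha-\beta)p\},$$ where $\frac1p+\frac1{p'}=1$ and $\frac{N}{0}=\infty$. (i) If $\alpha,\beta,p,q,\lambda$ are admissible of order $1$, then there is a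 constant $C>0$, depending only on $N,\alpha,\beta,p,q,\lambda$, such that $$\Big\|\frac{u}{|x|^{\beta}}\Big\|_{M^\lambda_q}\le C\,\big\||x|^{\alpha}\nabla u\big\|_{M^\lambda_p}$$ for every real-valued $u\in W^{1,1}_{\mathrm{loc}}(\mathbb{R}^N)$ (that is, $u$ is locally integrable with a locally integrable weak gradient $\nabla u$) with $|x|^\alpha u\in M^\lambda_p$. In particular, for $\alpha=0$, $\big\|u/|x|^{\beta}\big\|_{M^\lambda_q}\le C\|\nabla u\|_{M^\lambda_p}$ for every such $u\in M^\lambda_p$. (ii) If $\gamma\in(0,1)$ and $\alpha,\beta,p,q,\lambda$ are admissible of order $\gamma$, then there is a constant $C>0$, depending only on $N,\gamma,\alpha,\beta,p,q,\lambda$, such that $$\big\||x|^{-\beta}u\big\|_{M^\lambda_q}\le C\,\big\||x|^{\alpha}(-\Delta)^{\gamma/2}u\big\|_{M^\lambda_p}$$ for every real-valued Schwartz function $u$ on $\mathbb{R}^N$, where for $0<s<1$ $$(-\Delta)^{s}u(x)=\frac{A(N,s)}{2}\int_{\mathbb{R}^N}\frac{2u(x)-u(x+y)-u(x-y)}{|y|^{N+2s}}\,dy,\qquad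 A(N,s)=\frac{s\,4^{s}\,\Gamma(\frac N2+s)}{\pi^{N/2}\,\Gamma(1-s)}.$$ In particular, for $\alpha=0$, $\big\||x|^{-\beta}u\big\|_{M^\lambda_q}\le C\|(-\Delta)^{\gamma/2}u\|_{M^\lambda_p}$ for every such $u$. -/

import Mathlib

open MeasureTheory
open scoped ENNReal NNReal ContDiff

noncomputable section

/-- The global Morrey norm on `ℝ^N`,
`‖f‖ = (sup_x sup_{r > 0} r^{-lam} ∫_{B(x,r)} |f(y)|^p dy)^{1/p}`, with values in `[0, ∞]`. -/
def morreyNorm {N : ℕ} {F : Type*} [NormedAddCommGroup F] (p lam : ℝ)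
    (f : EuclideanSpace ℝ (Fin N) → F) : ℝ≥0∞ :=
  (⨆ (x : EuclideanSpace ℝ (Fin N)) (r : ℝ) (_ : 0 < r),
    ENNReal.ofReal (r ^ (-lam)) * ∫⁻ y in Metric.ball x r, ‖f y‖ₑ ^ p ∂volume) ^ (1 / p)

/-- Membership in the global Morrey space `M^lam_p(ℝ^N)`: `f` is measurable with finite Morrey
norm. For `0 < p`, finiteness of the norm already makes `|f|^p` integrable on every ball. -/
def MemMorrey {N : ℕ} {F : Type*} [NormedAddCommGroup F] (p lam : ℝ)
    (f : EuclideanSpace ℝ (Fin N) → F) : Prop :=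
  AEStronglyMeasurable f volume ∧ morreyNorm p lam f < ⊤

/-- `G` is the weak (distributional) gradient of `u` on `ℝ^N`: both are locally integrable and
`∫ u ∂_v φ = - ∫ φ ⟨G, v⟩` for all test functions `φ ∈ C_c^∞(ℝ^N)` and all directions `v`. -/
structure IsWeakGradient {N : ℕ} (u : EuclideanSpace ℝ (Fin N) → ℝ)
    (G : EuclideanSpace ℝ (Fin N) → EuclideanSpace ℝ (Fin N)) : Prop where
  locallyIntegrable : LocallyIntegrable u volume
  locallyIntegrable_grad : LocallyIntegrable G volume
  integral_eq : ∀ φ : EuclideanSpace ℝ (Fin N) → ℝ, ContDiff ℝ ∞ φ → HasCompactSupport φ →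
    ∀ v : EuclideanSpace ℝ (Fin N),
      ∫ x, u x * fderiv ℝ φ x v = - ∫ x, φ x * inner ℝ (G x) v

/-- The usual normalization constant
`A(N,s) = s 4^s Γ(N/2 + s) / (π^{N/2} Γ(1 - s))` of the fractional Laplacian, `0 < s < 1`. -/
def fracLaplacianConst (N : ℕ) (s : ℝ) : ℝ :=
  s * (4 : ℝ) ^ s * Real.Gamma ((N : ℝ) / 2 + s) /
    (Real.pi ^ ((N : ℝ) / 2) * Real.Gamma (1 - s))

/-- The fractional Laplacian `(-Δ)^s`, `0 < s < 1`, of a Schwartz function on `ℝ^N`,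
`(A(N,s)/2) ∫ (2u(x) - u(x+y) - u(x-y)) / |y|^{N+2s} dy`. The integral converges absolutely. -/
def fracLaplacian {N : ℕ} (s : ℝ) (u : SchwartzMap (EuclideanSpace ℝ (Fin N)) ℝ)
    (x : EuclideanSpace ℝ (Fin N)) : ℝ :=
  fracLaplacianConst N s / 2 *
    ∫ y : EuclideanSpace ℝ (Fin N), (2 * u x - u (x + y) - u (x - y)) / ‖y‖ ^ ((N : ℝ) + 2 * s)

/-- The conditions on the parameters at order `γ` in dimension `N`. The condition
`p < N / (γ - α - β)`, read as `p < ∞` when `α + β = γ`, is written without division, and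
`N * (1 - 1 / p)` is `N / p'` with `p'` the conjugate exponent of `p`. -/
structure HardySobolevAdmissible (N : ℕ) (γ α β p q lam : ℝ) : Prop where
  sum_nonneg : 0 ≤ α + β
  sum_le : α + β ≤ γ
  order_lt : γ < N
  one_lt_p : 1 < p
  p_lt : (γ - α - β) * p < N
  q_eq : 1 / q = 1 / p - (γ - α - β) / (N - lam)
  alpha_lt : α < N * (1 - 1 / p)
  beta_lt : β < (N - lam) / q
  lam_pos : 0 < lam
  lam_lt : lam < min (N - β * p) (N - (γ - α - β) * p)

end

/-! Both inequalities follow from one Stein–Weiss estimate for a Riesz potential in Morrey spaces,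
`scalePotential_morreyBound`, combined with a pointwise bound of `u` by the potential of order `γ`
of its gradient (`γ = 1`) or of its fractional Laplacian.

The estimate is a weighted form of Hedberg's argument. Write `δ = γ - α - β`, `a = (N - lam) / p`,
let `K` be the Morrey norm of `g = |x|^α f`, and read the potential as an integral over scales `r`
of the mass of `f` in `B(x,r)`. At scales `r ≤ |x|/2` the weight is comparable to `|x|^(-α)`. The
mass of `g` is bounded either by the maximal function `M g(x)` or by Morrey growth, and the best cut
between the two gives `|x|^β (M g)^(p/q) K^(1 - p/q)`, because `1 - δ/a = p/q`. At scales `r >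
|x|/2` the ball lies in `B(0,3r)`; Hölder's inequality, where `α < N/p'` enters, and convergence at
infinity, which is `β < (N - lam)/q`, give `|x|^β |x|^(-(N - lam)/q) K`. The `q`-th power of the
first bound is integrated by the boundedness of the maximal function on Morrey spaces
(`MorreyBound.maximal`), that of the second by the fact that `|x|^(-(N - lam))` has mass `O(r^lam)`
on every ball of radius `r`.

For the gradient, the `r`-derivative of a mollification of `u` at scale `r` is an integral of `G`
over `B(x,r)`. Integrating from `r = 0`, where the mollification tends to `u(x)` almost everywhere,
to `r = ∞`, where the Morrey hypothesis on `u` makes it vanish, bounds `u`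
(`IsWeakGradient.enorm_le_scalePotential`). For the fractional Laplacian, Fourier inversion and the
Gamma integral recover `u` from heat-kernel averages of `(-Δ)^s u`, and the superposition of these
Gaussians is dominated by the Riesz kernel (`SchwartzMap.enorm_le_scalePotential_fracLaplacian`). -/

/-! ### The Hardy–Littlewood maximal theorem -/

/-- The centred dyadic Hardy–Littlewood maximal function, normalised by `r ^ (-N)`. -/
noncomputable def dyadicMaximal {N : ℕ} (g : EuclideanSpace ℝ (Fin N) → ℝ≥0∞)
    (x : EuclideanSpace ℝ (Fin N)) : ℝ≥0∞ :=
  ⨆ k : ℤ, ENNReal.ofReal (((2 : ℝ) ^ k) ^ (-(N : ℝ))) * ∫⁻ y in Metric.ball x ((2 : ℝ) ^ k), g y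

lemma measurable_lintegral_ball {N : ℕ} {g : EuclideanSpace ℝ (Fin N) → ℝ≥0∞} (hg : Measurable g) :
    Measurable fun z : EuclideanSpace ℝ (Fin N) × ℝ => ∫⁻ y in Metric.ball z.1 z.2, g y := by
  have h : Measurable fun w : (EuclideanSpace ℝ (Fin N) × ℝ) × EuclideanSpace ℝ (Fin N) =>
      {w : (EuclideanSpace ℝ (Fin N) × ℝ) × EuclideanSpace ℝ (Fin N) |
        dist w.2 w.1.1 < w.1.2}.indicator (fun w => g w.2) w := by
    refine (hg.comp measurable_snd).indicator ?_
    exact measurableSet_lt (by fun_prop) (by fun_prop)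
  convert h.lintegral_prod_right' using 2 with z
  · rw [← lintegral_indicator Metric.isOpen_ball.measurableSet]
    rfl
  · infer_instance

lemma measurable_lintegral_ball_left {N : ℕ} {g : EuclideanSpace ℝ (Fin N) → ℝ≥0∞}
    (hg : Measurable g) (r : ℝ) :
    Measurable fun x : EuclideanSpace ℝ (Fin N) => ∫⁻ y in Metric.ball x r, g y := by
  have h : Measurable fun x : EuclideanSpace ℝ (Fin N) => (x, r) := by fun_prop
  have h2 := (measurable_lintegral_ball hg).comp h
  simpa only [Function.comp_def] using h2

lemma measurable_dyadicMaximal {N : ℕ} {g : EuclideanSpace ℝ (Fin N) → ℝ≥0∞} (hg : Measurable g) :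
    Measurable (dyadicMaximal g) := by
  unfold dyadicMaximal
  exact Measurable.iSup fun k => (measurable_lintegral_ball_left hg _).const_mul _

lemma ofReal_mul_ofReal_rpow_neg {r b : ℝ} (hr : 0 < r) :
    ENNReal.ofReal (r ^ b) * ENNReal.ofReal (r ^ (-b)) = 1 := by
  rw [← ENNReal.ofReal_mul (by positivity), ← Real.rpow_add hr]; simp

/-- Restricting to dyadic radii, which makes measurability a countable supremum, costs only the
factor `2^N`: a radius is rounded up to a power of two at most twice as large. -/
lemma lintegral_ball_le_dyadicMaximal {N : ℕ} (g : EuclideanSpace ℝ (Fin N) → ℝ≥0∞)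
    (x : EuclideanSpace ℝ (Fin N)) {r : ℝ} (hr : 0 < r) :
    ∫⁻ y in Metric.ball x r, g y ≤
      ENNReal.ofReal ((2 : ℝ) ^ N * r ^ (N : ℝ)) * dyadicMaximal g x := by
  obtain ⟨n, hn1, hn2⟩ := exists_mem_Ioc_zpow hr (one_lt_two : (1 : ℝ) < 2)
  set s : ℝ := (2 : ℝ) ^ (n + 1) with hs
  have hs0 : 0 < s := by positivity
  have hs2 : s ≤ 2 * r := by rw [hs, zpow_add₀ two_ne_zero]; simp; linarith
  calc ∫⁻ y in Metric.ball x r, g y ≤ ∫⁻ y in Metric.ball x s, g y :=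
        lintegral_mono_set (Metric.ball_subset_ball hn2)
    _ = ENNReal.ofReal (s ^ (N : ℝ)) * (ENNReal.ofReal (s ^ (-(N : ℝ))) *
          ∫⁻ y in Metric.ball x s, g y) := by
        rw [← mul_assoc, ofReal_mul_ofReal_rpow_neg hs0, one_mul]
    _ ≤ _ := by
        gcongr
        · rw [← Real.rpow_natCast 2 N, ← Real.mul_rpow (by norm_num) hr.le]
          exact Real.rpow_le_rpow hs0.le hs2 (by positivity)
        · exact le_iSup (fun k : ℤ => ENNReal.ofReal (((2 : ℝ) ^ k) ^ (-(N : ℝ))) *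
            ∫⁻ y in Metric.ball x ((2 : ℝ) ^ k), g y) (n + 1)

lemma volume_euclidean_ball {N : ℕ} (x : EuclideanSpace ℝ (Fin N)) {r : ℝ} (hr : 0 < r) :
    volume (Metric.ball x r) =
      ENNReal.ofReal (r ^ (N : ℝ)) * volume (Metric.ball (0 : EuclideanSpace ℝ (Fin N)) 1) := by
  rw [Measure.addHaar_ball_of_pos _ _ hr, finrank_euclideanSpace_fin, Real.rpow_natCast]

/-- The weak type `(1,1)` bound for the maximal function. -/
lemma dyadicMaximal_weak_type {N : ℕ} (hN : 0 < N) (g : EuclideanSpace ℝ (Fin N) → ℝ≥0∞)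
    {t : ℝ} (ht : 0 < t) :
    ENNReal.ofReal t * volume {x | ENNReal.ofReal t < dyadicMaximal g x} ≤
      ENNReal.ofReal ((5 : ℝ) ^ (N : ℝ)) * volume (Metric.ball (0 : EuclideanSpace ℝ (Fin N)) 1) *
        ∫⁻ x, g x := by
  have hV : volume (Metric.ball (0 : EuclideanSpace ℝ (Fin N)) 1) ≠ 0 :=
    (Metric.measure_ball_pos _ _ one_pos).ne'
  by_cases hI : ∫⁻ x, g x = ⊤
  · rw [hI, ENNReal.mul_top]
    · exact le_top
    · exact mul_ne_zero (by simp) hV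
  set S := {x | ENNReal.ofReal t < dyadicMaximal g x} with hS
  have hk : ∀ x ∈ S, ∃ k : ℤ, ENNReal.ofReal t <
      ENNReal.ofReal (((2 : ℝ) ^ k) ^ (-(N : ℝ))) * ∫⁻ y in Metric.ball x ((2 : ℝ) ^ k), g y :=
    fun x hx => lt_iSup_iff.1 hx
  choose! k hk using hk
  set r : EuclideanSpace ℝ (Fin N) → ℝ := fun x => (2 : ℝ) ^ k x with hr
  have hr0 : ∀ x, 0 < r x := fun x => by positivity
  have hk' : ∀ x ∈ S, ENNReal.ofReal t * ENNReal.ofReal (r x ^ (N : ℝ)) ≤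
      ∫⁻ y in Metric.ball x (r x), g y := by
    intro x hx
    calc ENNReal.ofReal t * ENNReal.ofReal (r x ^ (N : ℝ)) ≤
        ENNReal.ofReal (r x ^ (-(N : ℝ))) * (∫⁻ y in Metric.ball x (r x), g y) *
          ENNReal.ofReal (r x ^ (N : ℝ)) := by gcongr; exact (hk x hx).le
      _ = (ENNReal.ofReal (r x ^ (N : ℝ)) * ENNReal.ofReal (r x ^ (-(N : ℝ)))) *
          ∫⁻ y in Metric.ball x (r x), g y := by ring
      _ = _ := by rw [ofReal_mul_ofReal_rpow_neg (hr0 x), one_mul]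
  -- The Vitali covering lemma needs bounded radii. Each selected ball satisfies `t r^N ≤ ∫ g`, and
  -- `r ≤ r^N` once `r ≥ 1`, as `N > 0`.
  set A := (∫⁻ x, g x).toReal / t with hA
  have hR : ∀ x ∈ S, r x ≤ max 1 A := by
    intro x hx
    rcases le_total (r x) 1 with h | h
    · exact h.trans (le_max_left _ _)
    · refine le_trans ?_ (le_max_right _ _)
      have h1 : r x ≤ r x ^ (N : ℝ) := by
        conv_lhs => rw [← Real.rpow_one (r x)]
        exact Real.rpow_le_rpow_of_exponent_le h (by exact_mod_cast hN)
      refine h1.trans ?_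
      rw [hA, le_div_iff₀ ht, mul_comm]
      rw [← ENNReal.ofReal_le_iff_le_toReal hI, ENNReal.ofReal_mul ht.le]
      exact (hk' x hx).trans (setLIntegral_le_lintegral _ _)
  obtain ⟨u, huS, hu, hcov⟩ := Vitali.exists_disjoint_subfamily_covering_enlargement_ball S
    (fun x => x) r (max 1 A) hR 5 (by norm_num)
  have huc : u.Countable := hu.countable_of_isOpen (fun _ _ => Metric.isOpen_ball)
    (fun x _ => ⟨x, Metric.mem_ball_self (hr0 x)⟩)
  have hsub : S ⊆ ⋃ b ∈ u, Metric.ball b (5 * r b) := by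
    intro x hx
    obtain ⟨b, hb, h⟩ := hcov x hx
    exact Set.mem_biUnion hb (h (Metric.mem_ball_self (hr0 x)))
  set V := volume (Metric.ball (0 : EuclideanSpace ℝ (Fin N)) 1) with hVd
  calc ENNReal.ofReal t * volume S
      ≤ ENNReal.ofReal t * ∑' b : u, volume (Metric.ball (b : EuclideanSpace ℝ (Fin N)) (5 * r b)) := by
        gcongr
        exact (measure_mono hsub).trans (measure_biUnion_le _ huc _)
    _ = ∑' b : u, ENNReal.ofReal ((5 : ℝ) ^ (N : ℝ)) * V *
          (ENNReal.ofReal t * ENNReal.ofReal (r b ^ (N : ℝ))) := by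
        rw [← ENNReal.tsum_mul_left]
        congr 1 with b
        rw [volume_euclidean_ball _ (by have := hr0 b; positivity), Real.mul_rpow (by norm_num) (hr0 b).le,
          ENNReal.ofReal_mul (by positivity)]
        ring
    _ ≤ ∑' b : u, ENNReal.ofReal ((5 : ℝ) ^ (N : ℝ)) * V * ∫⁻ y in Metric.ball (b : EuclideanSpace ℝ (Fin N)) (r b), g y := by
        gcongr with b
        exact hk' b (huS b.2)
    _ = ENNReal.ofReal ((5 : ℝ) ^ (N : ℝ)) * V * ∫⁻ y in ⋃ b ∈ u, Metric.ball b (r b), g y := by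
        rw [ENNReal.tsum_mul_left, lintegral_biUnion huc (fun _ _ => Metric.isOpen_ball.measurableSet) hu]
    _ ≤ _ := by gcongr; exact Measure.restrict_le_self

/-- The layer-cake formula for a single value, obtained from the layer-cake theorem for a Dirac
mass. Stated for values in `[0, ∞]`, it needs no finiteness of the maximal function. -/
lemma lintegral_indicator_lt_rpow (a : ℝ≥0∞) {q : ℝ} (hq : 0 < q) :
    ∫⁻ t in Set.Ioi (0 : ℝ), {t : ℝ | ENNReal.ofReal t < a}.indicator
      (fun t => ENNReal.ofReal (q * t ^ (q - 1))) t = a ^ q := by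
  have key : ∀ b : ℝ, 0 ≤ b → ∫⁻ t in Set.Ioi (0 : ℝ), {t : ℝ | t < b}.indicator
      (fun t => ENNReal.ofReal (q * t ^ (q - 1))) t = ENNReal.ofReal b ^ q := by
    intro b hb
    have h := lintegral_rpow_eq_lintegral_meas_lt_mul (Measure.dirac ()) (f := fun _ => b)
      (Filter.Eventually.of_forall fun _ => hb) aemeasurable_const hq
    rw [lintegral_dirac] at h
    rw [ENNReal.ofReal_rpow_of_nonneg hb hq.le, h, ← lintegral_const_mul' _ _ ENNReal.ofReal_ne_top]
    congr 1 with t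
    by_cases htb : t < b
    · simp [htb, ENNReal.ofReal_mul hq.le]
    · simp [htb]
  rcases eq_or_ne a ⊤ with rfl | ha
  · rw [ENNReal.top_rpow_of_pos hq]
    refine ENNReal.eq_top_of_forall_nnreal_le fun r => ?_
    calc (r : ℝ≥0∞) = ENNReal.ofReal ((r : ℝ) ^ q⁻¹) ^ q := by
          rw [ENNReal.ofReal_rpow_of_nonneg (by positivity) hq.le, ← Real.rpow_mul (by positivity),
            inv_mul_cancel₀ hq.ne', Real.rpow_one, ENNReal.ofReal_coe_nnreal]
      _ ≤ _ := by
          rw [← key _ (by positivity)]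
          gcongr with t
          simp
  · rw [← ENNReal.ofReal_toReal ha, ← key _ ENNReal.toReal_nonneg, ENNReal.ofReal_toReal ha]
    refine setLIntegral_congr_fun measurableSet_Ioi fun t (ht : 0 < t) => ?_
    simp only [Set.indicator, Set.mem_ofPred_eq, ENNReal.ofReal_lt_iff_lt_toReal ht.le ha]

/-- The values of `g` not exceeding `s` contribute at most `s` times the volume of the unit ball to
each normalised integral. This truncation is what the Marcinkiewicz interpolation uses. -/
lemma dyadicMaximal_le_add_const {N : ℕ} (g : EuclideanSpace ℝ (Fin N) → ℝ≥0∞)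
    (s : ℝ≥0∞) (x : EuclideanSpace ℝ (Fin N)) :
    dyadicMaximal g x ≤ dyadicMaximal ({y | s < g y}.indicator g) x +
      s * volume (Metric.ball (0 : EuclideanSpace ℝ (Fin N)) 1) := by
  refine iSup_le fun k => ?_
  set r : ℝ := (2 : ℝ) ^ k
  have hr : 0 < r := by positivity
  calc ENNReal.ofReal (r ^ (-(N : ℝ))) * ∫⁻ y in Metric.ball x r, g y
      ≤ ENNReal.ofReal (r ^ (-(N : ℝ))) *
        ∫⁻ y in Metric.ball x r, ({y | s < g y}.indicator g y + s) := by
        gcongr with y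
        by_cases h : s < g y
        · simp [h]
        · simpa [h] using not_lt.1 h
    _ = ENNReal.ofReal (r ^ (-(N : ℝ))) * (∫⁻ y in Metric.ball x r, {y | s < g y}.indicator g y) +
        s * volume (Metric.ball (0 : EuclideanSpace ℝ (Fin N)) 1) := by
        rw [lintegral_add_right _ measurable_const, mul_add, lintegral_const,
          Measure.restrict_apply_univ, volume_euclidean_ball _ hr]
        congr 1
        calc _ = (ENNReal.ofReal (r ^ (N : ℝ)) * ENNReal.ofReal (r ^ (-(N : ℝ)))) *
              (s * volume (Metric.ball (0 : EuclideanSpace ℝ (Fin N)) 1)) := by ring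
          _ = _ := by rw [ofReal_mul_ofReal_rpow_neg hr, one_mul]
    _ ≤ _ := by
        gcongr
        exact le_iSup (fun k : ℤ => ENNReal.ofReal (((2 : ℝ) ^ k) ^ (-(N : ℝ))) *
          ∫⁻ y in Metric.ball x ((2 : ℝ) ^ k), {y | s < g y}.indicator g y) k

/-- The Hardy–Littlewood maximal theorem in `L^p`, `p > 1`. -/
theorem lintegral_dyadicMaximal_rpow_le {N : ℕ} (hN : 0 < N) {p : ℝ} (hp : 1 < p) :
    ∃ C : ℝ≥0, ∀ g : EuclideanSpace ℝ (Fin N) → ℝ≥0∞, Measurable g →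
      ∫⁻ x, dyadicMaximal g x ^ p ≤ C * ∫⁻ x, g x ^ p := by
  set V := volume (Metric.ball (0 : EuclideanSpace ℝ (Fin N)) 1) with hVd
  have hV : V ≠ 0 := (Metric.measure_ball_pos _ _ one_pos).ne'
  have hV' : V ≠ ⊤ := measure_ball_lt_top.ne
  -- With this `c`, truncating `g` at height `t * c` removes at most `t / 2` from its maximal
  -- function, so the weak type bound can be applied to the truncation at level `t / 2`.
  set c : ℝ≥0∞ := (2 * V)⁻¹ with hc
  have hc0 : c ≠ 0 := by simp [hc, ENNReal.mul_eq_top, hV']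
  have hc1 : c ≠ ⊤ := by simp [hc, hV]
  set D : ℝ≥0∞ := 2 * ENNReal.ofReal ((5 : ℝ) ^ (N : ℝ)) * V with hD
  have hD1 : D ≠ ⊤ := by simp [hD, ENNReal.mul_eq_top, hV']
  set C : ℝ≥0∞ := D * ENNReal.ofReal (p / (p - 1)) * (c⁻¹) ^ (p - 1) with hC
  have hC1 : C ≠ ⊤ := by
    refine ENNReal.mul_ne_top (ENNReal.mul_ne_top hD1 ENNReal.ofReal_ne_top) ?_
    exact ENNReal.rpow_ne_top_of_nonneg (by linarith) (by simpa using hc0)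
  refine ⟨C.toNNReal, fun g hg => ?_⟩
  rw [ENNReal.coe_toNNReal hC1]
  have hM := measurable_dyadicMaximal hg
  have weak : ∀ t : ℝ, 0 < t → volume {x | ENNReal.ofReal t < dyadicMaximal g x} ≤
      ENNReal.ofReal t⁻¹ * (D * ∫⁻ x, {x | ENNReal.ofReal t * c < g x}.indicator g x) := by
    intro t ht
    set h := {x | ENNReal.ofReal t * c < g x}.indicator g with hh
    have hsub : {x | ENNReal.ofReal t < dyadicMaximal g x} ⊆
        {x | ENNReal.ofReal (t / 2) < dyadicMaximal h x} := by
      intro x (hx : ENNReal.ofReal t < _)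
      have h1 := hx.trans_le (dyadicMaximal_le_add_const g (ENNReal.ofReal t * c) x)
      have h2 : ENNReal.ofReal t * c * V = ENNReal.ofReal (t / 2) := by
        rw [hc, ENNReal.mul_inv (by simp) (by simp), ENNReal.ofReal_div_of_pos (by norm_num),
          mul_assoc, mul_assoc, ENNReal.inv_mul_cancel hV hV', mul_one, div_eq_mul_inv]
        simp
      rw [← hVd, h2] at h1
      by_contra hcon
      have hcon : dyadicMaximal h x ≤ ENNReal.ofReal (t / 2) := not_lt.1 hcon
      have : dyadicMaximal h x + ENNReal.ofReal (t / 2) ≤ ENNReal.ofReal t := by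
        calc _ ≤ ENNReal.ofReal (t / 2) + ENNReal.ofReal (t / 2) := by gcongr
          _ = _ := by rw [← ENNReal.ofReal_add (by positivity) (by positivity), add_halves]
      exact absurd h1 (not_lt.2 this)
    have hw := dyadicMaximal_weak_type hN h (half_pos ht)
    calc volume {x | ENNReal.ofReal t < dyadicMaximal g x}
        ≤ volume {x | ENNReal.ofReal (t / 2) < dyadicMaximal h x} := measure_mono hsub
      _ = ENNReal.ofReal t⁻¹ * (2 * (ENNReal.ofReal (t / 2) *
            volume {x | ENNReal.ofReal (t / 2) < dyadicMaximal h x})) := by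
          have : ENNReal.ofReal t⁻¹ * 2 * ENNReal.ofReal (t / 2) = 1 := by
            rw [show (2 : ℝ≥0∞) = ENNReal.ofReal 2 by simp, ← ENNReal.ofReal_mul (by positivity),
              ← ENNReal.ofReal_mul (by positivity)]
            rw [show t⁻¹ * 2 * (t / 2) = 1 by field_simp]; simp
          rw [← mul_assoc, ← mul_assoc, this, one_mul]
      _ ≤ ENNReal.ofReal t⁻¹ * (2 * (ENNReal.ofReal ((5 : ℝ) ^ (N : ℝ)) * V * ∫⁻ x, h x)) := by
          gcongr
      _ = _ := by rw [hD]; ring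
  have hswap1 : ∫⁻ x, dyadicMaximal g x ^ p = ∫⁻ t in Set.Ioi (0 : ℝ),
      ENNReal.ofReal (p * t ^ (p - 1)) * volume {x | ENNReal.ofReal t < dyadicMaximal g x} := by
    simp_rw [← lintegral_indicator_lt_rpow _ (zero_lt_one.trans hp)]
    rw [lintegral_lintegral_swap]
    · congr 1 with t
      rw [← lintegral_indicator_const (measurableSet_lt measurable_const hM)]
      rfl
    · refine Measurable.aemeasurable ?_
      refine Measurable.indicator (f := fun z : EuclideanSpace ℝ (Fin N) × ℝ =>
        ENNReal.ofReal (p * z.2 ^ (p - 1)))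
        (s := {z | ENNReal.ofReal z.2 < dyadicMaximal g z.1}) (by fun_prop) ?_
      exact measurableSet_lt (by fun_prop) (hM.comp measurable_fst)
  have hlt : ∀ (t : ℝ) x, ENNReal.ofReal t * c < g x ↔ ENNReal.ofReal t < g x * c⁻¹ := by
    intro t x
    exact (ENNReal.lt_div_iff_mul_lt (Or.inl hc0) (Or.inl hc1)).symm
  rw [hswap1]
  -- The factor `t⁻¹` of the weak type bound lowers the exponent; `p / (p - 1)` then normalises the
  -- density to `(p - 1) t^(p - 2)`, so that the layer-cake formula applies with exponent `p - 1`.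
  -- It converges because `p > 1`.
  calc _ ≤ ∫⁻ t in Set.Ioi (0 : ℝ), ∫⁻ x, D * ENNReal.ofReal (p / (p - 1)) * (g x *
        {t : ℝ | ENNReal.ofReal t < g x * c⁻¹}.indicator
          (fun t => ENNReal.ofReal ((p - 1) * t ^ (p - 1 - 1))) t) := by
        refine setLIntegral_mono' measurableSet_Ioi fun t (ht : 0 < t) => ?_
        calc _ ≤ ENNReal.ofReal (p * t ^ (p - 1)) * (ENNReal.ofReal t⁻¹ *
              (D * ∫⁻ x, {x | ENNReal.ofReal t * c < g x}.indicator g x)) := by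
              gcongr; exact weak t ht
          _ = ENNReal.ofReal (p * t ^ (p - 1 - 1)) * D *
              ∫⁻ x, {x | ENNReal.ofReal t * c < g x}.indicator g x := by
              rw [Real.rpow_sub_one ht.ne' (p - 1), div_eq_mul_inv, ← mul_assoc p,
                ENNReal.ofReal_mul (p := p * t ^ (p - 1)) (by positivity)]
              ring
          _ ≤ _ := by
              rw [← lintegral_const_mul' _ _ (ENNReal.mul_ne_top ENNReal.ofReal_ne_top hD1)]
              refine lintegral_mono fun x => ?_
              by_cases hx : ENNReal.ofReal t * c < g x
              · have hx' := (hlt t x).1 hx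
                simp only [Set.indicator, Set.mem_ofPred_eq, hx, hx', if_true]
                have : ENNReal.ofReal (p * t ^ (p - 1 - 1)) = ENNReal.ofReal (p / (p - 1)) *
                    ENNReal.ofReal ((p - 1) * t ^ (p - 1 - 1)) := by
                  rw [← ENNReal.ofReal_mul (by apply div_nonneg <;> linarith)]
                  congr 1
                  have : p - 1 ≠ 0 := by linarith
                  field_simp
                rw [this]
                apply le_of_eq; ring
              · simp [Set.indicator, hx]
    _ = ∫⁻ x, D * ENNReal.ofReal (p / (p - 1)) * (g x * (g x * c⁻¹) ^ (p - 1)) := by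
        rw [lintegral_lintegral_swap]
        · congr 1 with x
          have hm : Measurable fun t : ℝ => {t : ℝ | ENNReal.ofReal t < g x * c⁻¹}.indicator
              (fun t => ENNReal.ofReal ((p - 1) * t ^ (p - 1 - 1))) t :=
            Measurable.indicator (by fun_prop) (measurableSet_lt (by fun_prop) (by fun_prop))
          rw [lintegral_const_mul _ (hm.const_mul _), lintegral_const_mul _ hm,
            lintegral_indicator_lt_rpow _ (by linarith)]
        · refine Measurable.aemeasurable ?_
          refine Measurable.const_mul ?_ _
          refine Measurable.mul (by fun_prop) ?_
          refine Measurable.indicator (f := fun z : ℝ × EuclideanSpace ℝ (Fin N) =>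
            ENNReal.ofReal ((p - 1) * z.1 ^ (p - 1 - 1)))
            (s := {z | ENNReal.ofReal z.1 < g z.2 * c⁻¹}) (by fun_prop) ?_
          exact measurableSet_lt (by fun_prop) (by fun_prop)
    _ = ∫⁻ x, C * g x ^ p := by
        congr 1 with x
        rw [ENNReal.mul_rpow_of_nonneg _ _ (by linarith), hC]
        have : g x ^ p = g x * g x ^ (p - 1) := by
          conv_rhs => enter [1]; rw [← ENNReal.rpow_one (g x)]
          rw [← ENNReal.rpow_add_of_nonneg _ _ (by norm_num) (by linarith)]
          congr 1; ring
        rw [this]; ring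
    _ ≤ _ := by rw [lintegral_const_mul' _ _ hC1]

/-! ### Power weights on balls centred at the origin -/

lemma lintegral_comp_smul_euclidean {N : ℕ} {f : EuclideanSpace ℝ (Fin N) → ℝ≥0∞}
    (hf : Measurable f) {R : ℝ} (hR : 0 < R) :
    ∫⁻ x, f (R • x) = ENNReal.ofReal (R ^ (-(N : ℝ))) * ∫⁻ x, f x := by
  have h := lintegral_map (μ := volume) hf (measurable_const_smul (α := EuclideanSpace ℝ (Fin N)) R)
  rw [Measure.map_addHaar_smul _ hR.ne', lintegral_smul_measure, smul_eq_mul,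
    finrank_euclideanSpace_fin, abs_of_pos (by positivity), ← Real.rpow_natCast,
    ← Real.rpow_neg hR.le] at h
  exact h.symm

/-- By homogeneity the constant is the integral over the unit ball, finite since `b < N`. -/
lemma lintegral_ball_norm_rpow_neg_le {N : ℕ} (hN : 0 < N) {b : ℝ} (hb : b < N) :
    ∃ C : ℝ≥0, ∀ R : ℝ, 0 < R →
      ∫⁻ y in Metric.ball (0 : EuclideanSpace ℝ (Fin N)) R, ENNReal.ofReal (‖y‖ ^ (-b)) ≤
        C * ENNReal.ofReal (R ^ (N - b)) := by
  set I := ∫⁻ y in Metric.ball (0 : EuclideanSpace ℝ (Fin N)) 1, ENNReal.ofReal (‖y‖ ^ (-b)) with hI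
  have hI' : I ≠ ⊤ := by
    have h := integrableOn_ball_of_norm_le_rpow (E := EuclideanSpace ℝ (Fin N)) (μ := volume)
      (f := fun y => ‖y‖ ^ (-b)) (C := 1) (α := b) (r := 1)
      (by rw [finrank_euclideanSpace_fin]; exact hN) (by rw [finrank_euclideanSpace_fin]; exact hb)
      (Filter.Eventually.of_forall fun y => by
        rw [Real.norm_of_nonneg (by positivity), one_mul])
      (measurable_norm.pow_const _).aestronglyMeasurable
    exact h.lintegral_lt_top.ne
  refine ⟨I.toNNReal, fun R hR => ?_⟩
  rw [ENNReal.coe_toNNReal hI']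
  apply le_of_eq
  set F : EuclideanSpace ℝ (Fin N) → ℝ≥0∞ :=
    (Metric.ball (0 : EuclideanSpace ℝ (Fin N)) R).indicator
      fun y => ENNReal.ofReal (‖y‖ ^ (-b)) with hF
  have hFm : Measurable F := by
    refine Measurable.indicator ?_ Metric.isOpen_ball.measurableSet
    fun_prop
  have h1 := lintegral_comp_smul_euclidean hFm hR
  have h2 : ∀ x, F (R • x) = ENNReal.ofReal (R ^ (-b)) *
      (Metric.ball (0 : EuclideanSpace ℝ (Fin N)) 1).indicator
      (fun y => ENNReal.ofReal (‖y‖ ^ (-b))) x := by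
    intro x
    have hiff : R • x ∈ Metric.ball (0 : EuclideanSpace ℝ (Fin N)) R ↔
        x ∈ Metric.ball (0 : EuclideanSpace ℝ (Fin N)) 1 := by
      rw [mem_ball_zero_iff, mem_ball_zero_iff, norm_smul, Real.norm_of_nonneg hR.le]
      exact mul_lt_iff_lt_one_right hR
    by_cases hx : x ∈ Metric.ball (0 : EuclideanSpace ℝ (Fin N)) 1
    · rw [hF, Set.indicator_of_mem (hiff.2 hx), Set.indicator_of_mem hx,
        ← ENNReal.ofReal_mul (by positivity), norm_smul, Real.norm_of_nonneg hR.le,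
        Real.mul_rpow hR.le (norm_nonneg _)]
    · rw [hF, Set.indicator_of_notMem (fun h => hx (hiff.1 h)), Set.indicator_of_notMem hx, mul_zero]
  simp_rw [h2] at h1
  rw [lintegral_const_mul' _ _ ENNReal.ofReal_ne_top,
    lintegral_indicator Metric.isOpen_ball.measurableSet, ← hI, hF,
    lintegral_indicator Metric.isOpen_ball.measurableSet] at h1
  calc _ = ENNReal.ofReal (R ^ (N : ℝ)) * ENNReal.ofReal (R ^ (-(N : ℝ))) * _ := by
        rw [ofReal_mul_ofReal_rpow_neg hR, one_mul]
    _ = _ := by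
        rw [mul_assoc, ← h1, ← mul_assoc, ← ENNReal.ofReal_mul (by positivity), ← Real.rpow_add hR,
          mul_comm, sub_eq_add_neg]

/-! ### Morrey bounds, Hölder's inequality and the maximal function on Morrey spaces -/

/-- `‖g‖_{M^lam_p} ≤ K`, unfolded. -/
def MorreyBound {N : ℕ} (p lam : ℝ) (K : ℝ≥0∞) (g : EuclideanSpace ℝ (Fin N) → ℝ≥0∞) : Prop :=
  ∀ (x : EuclideanSpace ℝ (Fin N)) (r : ℝ), 0 < r →
    ∫⁻ y in Metric.ball x r, g y ^ p ≤ ENNReal.ofReal (r ^ lam) * K ^ p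

lemma MorreyBound.mono {N : ℕ} {p lam : ℝ} (hp : 0 ≤ p) {K L : ℝ≥0∞} (hKL : K ≤ L)
    {g : EuclideanSpace ℝ (Fin N) → ℝ≥0∞} (h : MorreyBound p lam K g) : MorreyBound p lam L g :=
  fun x r hr => (h x r hr).trans (by gcongr)

lemma MorreyBound.congr {N : ℕ} {p lam : ℝ} {K : ℝ≥0∞}
    {g h : EuclideanSpace ℝ (Fin N) → ℝ≥0∞} (H : MorreyBound p lam K g) (hgh : h ≤ᵐ[volume] g)
    (hp : 0 ≤ p) : MorreyBound p lam K h := by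
  intro x r hr
  refine le_trans (lintegral_mono_ae ?_) (H x r hr)
  filter_upwards [ae_restrict_of_ae hgh] with y hy
  gcongr

lemma morreyBound_morreyNorm {N : ℕ} {F : Type*} [NormedAddCommGroup F] {p lam : ℝ} (hp : 0 < p)
    (f : EuclideanSpace ℝ (Fin N) → F) : MorreyBound p lam (morreyNorm p lam f) (fun y => ‖f y‖ₑ) := by
  intro x r hr
  rw [morreyNorm, ← ENNReal.rpow_mul, one_div, inv_mul_cancel₀ hp.ne', ENNReal.rpow_one]
  calc _ = ENNReal.ofReal (r ^ lam) * ENNReal.ofReal (r ^ (-lam)) *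
        ∫⁻ y in Metric.ball x r, ‖f y‖ₑ ^ p := by rw [ofReal_mul_ofReal_rpow_neg hr, one_mul]
    _ ≤ _ := by
        rw [mul_assoc]
        gcongr
        exact le_iSup_of_le x (le_iSup_of_le r (le_iSup_of_le hr le_rfl))

lemma MorreyBound.morreyNorm_le {N : ℕ} {F : Type*} [NormedAddCommGroup F] {p lam : ℝ} (hp : 0 < p)
    {f : EuclideanSpace ℝ (Fin N) → F} {K : ℝ≥0∞} (h : MorreyBound p lam K (fun y => ‖f y‖ₑ)) :
    morreyNorm p lam f ≤ K := by
  rw [morreyNorm, one_div, ENNReal.rpow_inv_le_iff hp]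
  refine iSup_le fun x => iSup_le fun r => iSup_le fun hr => ?_
  calc _ ≤ ENNReal.ofReal (r ^ (-lam)) * (ENNReal.ofReal (r ^ lam) * K ^ p) := by
        gcongr; exact h x r hr
    _ = K ^ p := by
        rw [← mul_assoc, mul_comm (ENNReal.ofReal _), ofReal_mul_ofReal_rpow_neg hr, one_mul]

/-- Hölder's inequality; `(1 - 1 / p)⁻¹` is the conjugate exponent `p'`. -/
lemma MorreyBound.lintegral_mul_le {N : ℕ} {p lam : ℝ} (hp : 1 < p) {K : ℝ≥0∞}
    {g w : EuclideanSpace ℝ (Fin N) → ℝ≥0∞} (hg : Measurable g) (hw : Measurable w)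
    (h : MorreyBound p lam K g) (x : EuclideanSpace ℝ (Fin N)) {r : ℝ} (hr : 0 < r) :
    ∫⁻ y in Metric.ball x r, w y * g y ≤
      (∫⁻ y in Metric.ball x r, w y ^ (1 - 1 / p)⁻¹) ^ (1 - 1 / p) *
        (ENNReal.ofReal (r ^ (lam / p)) * K) := by
  have hp0 : 0 < p := by linarith
  have hpq : (1 - 1 / p)⁻¹.HolderConjugate p := by
    have h1 : p.HolderConjugate (1 - 1 / p)⁻¹ := by
      rw [Real.holderConjugate_iff]
      refine ⟨hp, ?_⟩
      rw [inv_inv, one_div]; ring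
    exact h1.symm
  have h0 := ENNReal.lintegral_mul_le_Lp_mul_Lq (volume.restrict (Metric.ball x r)) hpq
    hw.aemeasurable hg.aemeasurable
  rw [one_div (1 - 1 / p)⁻¹, inv_inv] at h0
  refine h0.trans ?_
  gcongr
  calc _ ≤ (ENNReal.ofReal (r ^ lam) * K ^ p) ^ (1 / p) := by gcongr; exact h x r hr
    _ = _ := by
      rw [ENNReal.mul_rpow_of_nonneg _ _ (by positivity), ← ENNReal.rpow_mul,
        mul_one_div_cancel hp0.ne', ENNReal.rpow_one,
        ENNReal.ofReal_rpow_of_nonneg (by positivity) (by positivity), ← Real.rpow_mul hr.le,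
        mul_one_div]

/-- After Hölder's inequality the weight is `|y|^(-α p')`, and `α < N / p'` says exactly that `α p'
< N`. -/
lemma MorreyBound.lintegral_ball_zero_le {N : ℕ} (hN : 0 < N) {p lam α : ℝ} (hp : 1 < p)
    (hα : α < N * (1 - 1 / p)) :
    ∃ C : ℝ≥0, ∀ (K : ℝ≥0∞) (g : EuclideanSpace ℝ (Fin N) → ℝ≥0∞), Measurable g →
      MorreyBound p lam K g → ∀ R : ℝ, 0 < R →
        ∫⁻ y in Metric.ball 0 R, ENNReal.ofReal (‖y‖ ^ (-α)) * g y ≤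
          C * ENNReal.ofReal (R ^ (N - α - (N - lam) / p)) * K := by
  have hp' : 0 < 1 - 1 / p := by
    rw [sub_pos, div_lt_one (by linarith)]; exact hp
  obtain ⟨C, hC⟩ := lintegral_ball_norm_rpow_neg_le hN (b := α * (1 - 1 / p)⁻¹)
    (by rw [← div_eq_mul_inv, div_lt_iff₀ hp']; exact hα)
  refine ⟨C ^ (1 - 1 / p), fun K g hg h R hR => ?_⟩
  refine (h.lintegral_mul_le hp hg (w := fun y => ENNReal.ofReal (‖y‖ ^ (-α))) (by fun_prop) 0 hR).trans ?_
  have h1 : ∀ y : EuclideanSpace ℝ (Fin N), ENNReal.ofReal (‖y‖ ^ (-α)) ^ (1 - 1 / p)⁻¹ =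
      ENNReal.ofReal (‖y‖ ^ (-(α * (1 - 1 / p)⁻¹))) := by
    intro y
    rw [ENNReal.ofReal_rpow_of_nonneg (by positivity) (by positivity),
      ← Real.rpow_mul (norm_nonneg _), neg_mul]
  simp_rw [h1]
  calc _ ≤ (C * ENNReal.ofReal (R ^ (N - α * (1 - 1 / p)⁻¹))) ^ (1 - 1 / p) *
        (ENNReal.ofReal (R ^ (lam / p)) * K) := by gcongr; exact hC R hR
    _ = _ := by
      rw [ENNReal.mul_rpow_of_nonneg _ _ hp'.le, ENNReal.coe_rpow_of_nonneg _ hp'.le,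
        ENNReal.ofReal_rpow_of_nonneg (by positivity) hp'.le, ← Real.rpow_mul hR.le, mul_assoc,
        ← mul_assoc (ENNReal.ofReal _), ← ENNReal.ofReal_mul (by positivity), ← Real.rpow_add hR,
        mul_assoc]
      congr 4
      rw [sub_mul, mul_assoc, inv_mul_cancel₀ hp'.ne']
      ring

lemma MorreyBound.lintegral_ball_le {N : ℕ} {p lam : ℝ} (hp : 1 < p) :
    ∃ C : ℝ≥0, ∀ (K : ℝ≥0∞) (g : EuclideanSpace ℝ (Fin N) → ℝ≥0∞), Measurable g →
      MorreyBound p lam K g → ∀ (x : EuclideanSpace ℝ (Fin N)) (R : ℝ), 0 < R →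
        ∫⁻ y in Metric.ball x R, g y ≤ C * ENNReal.ofReal (R ^ (N - (N - lam) / p)) * K := by
  have hp' : 0 < 1 - 1 / p := by
    rw [sub_pos, div_lt_one (by linarith)]; exact hp
  set V := volume (Metric.ball (0 : EuclideanSpace ℝ (Fin N)) 1)
  have hV : V ≠ ⊤ := measure_ball_lt_top.ne
  refine ⟨(V ^ (1 - 1 / p)).toNNReal, fun K g hg h x R hR => ?_⟩
  rw [ENNReal.coe_toNNReal (ENNReal.rpow_ne_top_of_nonneg hp'.le hV)]
  have h1 := h.lintegral_mul_le hp hg (w := fun y => 1) measurable_const x hR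
  simp only [one_mul, ENNReal.one_rpow, lintegral_const, Measure.restrict_apply_univ,
    volume_euclidean_ball x hR] at h1
  refine h1.trans (le_of_eq ?_)
  rw [ENNReal.mul_rpow_of_nonneg _ _ hp'.le,
    ENNReal.ofReal_rpow_of_nonneg (by positivity) hp'.le, ← Real.rpow_mul hR.le,
    mul_comm _ (V ^ _), mul_assoc, ← mul_assoc (ENNReal.ofReal _),
    ← ENNReal.ofReal_mul (by positivity), ← Real.rpow_add hR, mul_assoc]
  congr 4
  ring

/-- If `‖x‖ < 2 r` the ball lies in `B(0, 3r)` and homogeneity applies; otherwise `‖y‖ ≥ r` on the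
ball and the weight is at most `r^(-(N - lam))`. This integrates the far part of the potential. -/
lemma lintegral_ball_norm_rpow_le {N : ℕ} (hN : 0 < N) {lam : ℝ} (h0 : 0 < lam) (h1 : lam ≤ N) :
    ∃ C : ℝ≥0, ∀ (x : EuclideanSpace ℝ (Fin N)) (r : ℝ), 0 < r →
      ∫⁻ y in Metric.ball x r, ENNReal.ofReal (‖y‖ ^ (-(N - lam))) ≤ C * ENNReal.ofReal (r ^ lam) := by
  obtain ⟨C, hC⟩ := lintegral_ball_norm_rpow_neg_le hN (b := N - lam) (by linarith)
  set V := volume (Metric.ball (0 : EuclideanSpace ℝ (Fin N)) 1)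
  have hV : V ≠ ⊤ := measure_ball_lt_top.ne
  refine ⟨C * Real.toNNReal (3 ^ lam) + V.toNNReal, fun x r hr => ?_⟩
  push_cast
  rw [ENNReal.coe_toNNReal hV, add_mul]
  rcases lt_or_ge ‖x‖ (2 * r) with h | h
  · refine le_trans ?_ le_self_add
    calc _ ≤ ∫⁻ y in Metric.ball (0 : EuclideanSpace ℝ (Fin N)) (3 * r),
          ENNReal.ofReal (‖y‖ ^ (-(N - lam))) := by
          refine lintegral_mono_set (Metric.ball_subset_ball' ?_)
          rw [dist_zero_right]; linarith
      _ ≤ C * ENNReal.ofReal ((3 * r) ^ (N - (N - lam))) := hC _ (by positivity)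
      _ = _ := by
          rw [sub_sub_cancel, Real.mul_rpow (by norm_num) hr.le, ENNReal.ofReal_mul (by positivity),
            mul_assoc]
          rfl
  · refine le_trans ?_ le_add_self
    calc _ ≤ ∫⁻ y in Metric.ball x r, ENNReal.ofReal (r ^ (-(N - lam))) := by
          refine setLIntegral_mono' Metric.isOpen_ball.measurableSet fun y hy => ?_
          refine ENNReal.ofReal_le_ofReal (Real.rpow_le_rpow_of_nonpos hr ?_ (by linarith))
          rw [Metric.mem_ball, dist_eq_norm, norm_sub_rev] at hy
          have := norm_sub_norm_le x y
          linarith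
      _ = _ := by
          rw [lintegral_const, Measure.restrict_apply_univ, volume_euclidean_ball x hr, ← mul_assoc,
            ← ENNReal.ofReal_mul (by positivity), ← Real.rpow_add hr, mul_comm]
          congr 3
          ring

/-- The maximal function is bounded on Morrey spaces. -/
theorem MorreyBound.maximal {N : ℕ} (hN : 0 < N) {p lam : ℝ} (hp : 1 < p) (hl : lam ≤ N) :
    ∃ C : ℝ≥0, ∀ (K : ℝ≥0∞) (g : EuclideanSpace ℝ (Fin N) → ℝ≥0∞), Measurable g →
      MorreyBound p lam K g → MorreyBound p lam (C * K) (dyadicMaximal g) := by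
  have hp0 : 0 < p := by linarith
  obtain ⟨A, hA⟩ := lintegral_dyadicMaximal_rpow_le hN hp
  obtain ⟨B, hB⟩ := MorreyBound.lintegral_ball_le (N := N) (lam := lam) hp
  set V := volume (Metric.ball (0 : EuclideanSpace ℝ (Fin N)) 1)
  have hV : V ≠ ⊤ := measure_ball_lt_top.ne
  set D : ℝ≥0 := 2 ^ (p - 1) * (A * Real.toNNReal (2 ^ lam) + B ^ p * V.toNNReal) with hD
  refine ⟨D ^ (1 / p), fun K g hg h x r hr => ?_⟩
  have hDK : ((D ^ (1 / p) : ℝ≥0) * K : ℝ≥0∞) ^ p = D * K ^ p := by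
    rw [ENNReal.mul_rpow_of_nonneg _ _ hp0.le, ← ENNReal.coe_rpow_of_nonneg _ hp0.le,
      ← NNReal.rpow_mul, one_div_mul_cancel hp0.ne', NNReal.rpow_one]
  rw [hDK]
  set a := (N - lam) / p with ha
  have ha0 : 0 ≤ a := div_nonneg (by linarith) hp0.le
  -- Local and global parts: for `z` in `B(x,r)`, scales below `r` see only `g₁`, to which the `L^p`
  -- maximal theorem applies. At scales `s ≥ r` Morrey growth bounds the average by a multiple of
  -- `s^(-a) K ≤ r^(-a) K`.
  set g₁ := (Metric.ball x (2 * r)).indicator g with hg₁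
  have hg₁m : Measurable g₁ := hg.indicator Metric.isOpen_ball.measurableSet
  have hpt : ∀ z ∈ Metric.ball x r, dyadicMaximal g z ≤
      dyadicMaximal g₁ z + B * ENNReal.ofReal (r ^ (-a)) * K := by
    intro z hz
    refine iSup_le fun k => ?_
    set s : ℝ := (2 : ℝ) ^ k with hs
    have hs0 : 0 < s := by positivity
    rcases lt_or_ge s r with hsr | hsr
    · refine le_trans ?_ le_self_add
      refine le_trans (le_of_eq ?_) (le_iSup (fun k : ℤ => ENNReal.ofReal (((2 : ℝ) ^ k) ^ (-(N : ℝ))) *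
            ∫⁻ y in Metric.ball z ((2 : ℝ) ^ k), g₁ y) k)
      congr 1
      refine setLIntegral_congr_fun Metric.isOpen_ball.measurableSet fun y hy => ?_
      rw [hg₁, Set.indicator_of_mem]
      rw [Metric.mem_ball] at *
      linarith [dist_triangle y z x]
    · refine le_trans ?_ le_add_self
      calc _ ≤ ENNReal.ofReal (s ^ (-(N : ℝ))) * (B * ENNReal.ofReal (s ^ (N - a)) * K) := by
            gcongr; exact hB K g hg h z s hs0
        _ = B * (ENNReal.ofReal (s ^ (-(N : ℝ))) * ENNReal.ofReal (s ^ (N - a))) * K := by ring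
        _ = B * ENNReal.ofReal (s ^ (-a)) * K := by
            rw [← ENNReal.ofReal_mul (by positivity), ← Real.rpow_add hs0]
            congr 4; ring
        _ ≤ _ := by
            gcongr (B : ℝ≥0∞) * ENNReal.ofReal ?_ * K
            exact Real.rpow_le_rpow_of_nonpos hr hsr (by linarith)
  have hfin : (2 : ℝ≥0∞) ^ (p - 1) ≠ ⊤ := ENNReal.rpow_ne_top_of_nonneg (by linarith) (by simp)
  calc ∫⁻ z in Metric.ball x r, dyadicMaximal g z ^ p
      ≤ ∫⁻ z in Metric.ball x r, 2 ^ (p - 1) * (dyadicMaximal g₁ z ^ p +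
          (B * ENNReal.ofReal (r ^ (-a)) * K) ^ p) := by
        refine setLIntegral_mono' Metric.isOpen_ball.measurableSet fun z hz => ?_
        refine le_trans ?_ (ENNReal.rpow_add_le_mul_rpow_add_rpow _ _ hp.le)
        gcongr
        exact hpt z hz
    _ = 2 ^ (p - 1) * ((∫⁻ z in Metric.ball x r, dyadicMaximal g₁ z ^ p) +
          (B * ENNReal.ofReal (r ^ (-a)) * K) ^ p * (ENNReal.ofReal (r ^ (N : ℝ)) * V)) := by
        rw [lintegral_const_mul' _ _ hfin, lintegral_add_right _ measurable_const, lintegral_const,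
          Measure.restrict_apply_univ, volume_euclidean_ball x hr]
    _ ≤ 2 ^ (p - 1) * (A * (ENNReal.ofReal ((2 * r) ^ lam) * K ^ p) +
          (B * ENNReal.ofReal (r ^ (-a)) * K) ^ p * (ENNReal.ofReal (r ^ (N : ℝ)) * V)) := by
        gcongr
        refine (setLIntegral_le_lintegral _ _).trans ((hA g₁ hg₁m).trans ?_)
        gcongr
        refine le_trans (le_of_eq ?_) (h x (2 * r) (by positivity))
        rw [← lintegral_indicator Metric.isOpen_ball.measurableSet]
        congr 1 with y
        by_cases hy : y ∈ Metric.ball x (2 * r)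
        · rw [hg₁, Set.indicator_of_mem hy, Set.indicator_of_mem hy]
        · rw [hg₁, Set.indicator_of_notMem hy, Set.indicator_of_notMem hy, ENNReal.zero_rpow_of_pos hp0]
    _ = ENNReal.ofReal (r ^ lam) * (D * K ^ p) := by
        rw [Real.mul_rpow (by norm_num) hr.le, ENNReal.ofReal_mul (by positivity),
          ENNReal.mul_rpow_of_nonneg _ _ hp0.le, ENNReal.mul_rpow_of_nonneg _ _ hp0.le,
          ENNReal.ofReal_rpow_of_nonneg (by positivity) hp0.le, ← Real.rpow_mul hr.le]
        have h1 : ENNReal.ofReal (r ^ lam) =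
            ENNReal.ofReal (r ^ (-a * p)) * ENNReal.ofReal (r ^ (N : ℝ)) := by
          rw [← ENNReal.ofReal_mul (by positivity), ← Real.rpow_add hr, ha]
          congr 2
          field_simp
          ring
        have h2 : (D : ℝ≥0∞) = 2 ^ (p - 1) * (A * ENNReal.ofReal (2 ^ lam) + B ^ p * V) := by
          rw [hD]
          push_cast
          rw [ENNReal.coe_toNNReal hV, ENNReal.coe_rpow_of_nonneg _ hp0.le,
            ENNReal.coe_rpow_of_nonneg _ (by linarith)]
          rfl
        rw [h2, mul_add, mul_add, add_mul, mul_add]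
        congr 1
        · ring
        · rw [h1]; ring

/-! ### The Stein–Weiss inequality for the Riesz potential in Morrey spaces -/

/-- The Riesz-type potential `∫_0^∞ r^{γ - N - 1} ∫_{B(x,r)} f(y) dy dr`, which is a multiple of
`∫ f(y) |x - y|^{γ - N} dy`. -/
noncomputable def scalePotential {N : ℕ} (γ : ℝ) (f : EuclideanSpace ℝ (Fin N) → ℝ≥0∞)
    (x : EuclideanSpace ℝ (Fin N)) : ℝ≥0∞ :=
  ∫⁻ r in Set.Ioi (0 : ℝ), ENNReal.ofReal (r ^ (γ - N - 1)) * ∫⁻ y in Metric.ball x r, f y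

lemma scalePotential_congr {N : ℕ} (γ : ℝ) {f g : EuclideanSpace ℝ (Fin N) → ℝ≥0∞}
    (h : f =ᵐ[volume] g) : scalePotential γ f = scalePotential γ g := by
  ext x
  unfold scalePotential
  congr 1 with r
  rw [lintegral_congr_ae (ae_restrict_of_ae h)]

lemma lintegral_Ioc_rpow {b R : ℝ} (hb : 0 < b) (hR : 0 ≤ R) :
    ∫⁻ r in Set.Ioc 0 R, ENNReal.ofReal (r ^ (b - 1)) = ENNReal.ofReal (R ^ b / b) := by
  have hi : IntervalIntegrable (fun r : ℝ => r ^ (b - 1)) volume 0 R :=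
    intervalIntegral.intervalIntegrable_rpow' (by linarith)
  rw [← ofReal_integral_eq_lintegral_ofReal
    ((intervalIntegrable_iff_integrableOn_Ioc_of_le hR).1 hi), ← intervalIntegral.integral_of_le hR,
    integral_rpow (Or.inl (by linarith))]
  · simp [Real.zero_rpow hb.ne']
  · filter_upwards [ae_restrict_mem measurableSet_Ioc] with r hr
    exact Real.rpow_nonneg hr.1.le _

lemma lintegral_Ioi_rpow_neg {b R : ℝ} (hb : 0 < b) (hR : 0 < R) :
    ∫⁻ r in Set.Ioi R, ENNReal.ofReal (r ^ (-b - 1)) = ENNReal.ofReal (R ^ (-b) / b) := by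
  rw [← ofReal_integral_eq_lintegral_ofReal
    (integrableOn_Ioi_rpow_of_lt (by linarith) hR), integral_Ioi_rpow_of_lt (by linarith) hR]
  · congr 1
    rw [sub_add_cancel, neg_div_neg_eq]
  · filter_upwards [ae_restrict_mem measurableSet_Ioi] with r hr
    exact Real.rpow_nonneg (hR.trans hr).le _

lemma rpow_neg_le_of_comparable {s t α : ℝ} (ht : 0 < t) (h1 : t / 2 ≤ s) (h2 : s ≤ 2 * t) :
    s ^ (-α) ≤ 2 ^ |α| * t ^ (-α) := by
  have hs : 0 < s := by linarith
  rcases le_total 0 α with h | h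
  · calc s ^ (-α) ≤ (t / 2) ^ (-α) :=
          Real.rpow_le_rpow_of_nonpos (by positivity) h1 (by linarith)
      _ = _ := by
          rw [abs_of_nonneg h, Real.div_rpow ht.le (by norm_num), Real.rpow_neg (by norm_num : (0:ℝ) ≤ 2)]
          field_simp
  · calc s ^ (-α) ≤ (2 * t) ^ (-α) := Real.rpow_le_rpow hs.le h2 (by linarith)
      _ = _ := by rw [abs_of_nonpos h, Real.mul_rpow (by norm_num) ht.le]

/-- At scales `r ≤ ‖x‖ / 2` every `y` in the ball has norm comparable to `‖x‖`, so the weight leaves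
the integral. Below `R` the bound by `M` gives the integrand `r^(γ - 1)`, above `R` the bound by `K`
gives `r^(γ - a - 1)`. In both ranges a power `α + β ≥ 0` of the scale is traded for the same power
of `‖x‖`, which leaves `R^δ` and `R^(δ - a)`. Here `R` stays free, to be optimised later. -/
lemma lintegral_near_le {N : ℕ} {γ α β δ a : ℝ} (hγ : 0 < γ) (hsum : 0 ≤ α + β)
    (hδ : δ = γ - α - β) (hδ0 : 0 ≤ δ) (hδa : δ < a) {A B : ℝ≥0}
    {g : EuclideanSpace ℝ (Fin N) → ℝ≥0∞} {M K : ℝ≥0∞}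
    {x : EuclideanSpace ℝ (Fin N)} (hx : x ≠ 0)
    (h1 : ∀ r : ℝ, 0 < r → ∫⁻ y in Metric.ball x r, g y ≤ A * ENNReal.ofReal (r ^ (N : ℝ)) * M)
    (h2 : ∀ r : ℝ, 0 < r → ∫⁻ y in Metric.ball x r, g y ≤ B * ENNReal.ofReal (r ^ (N - a)) * K)
    {R : ℝ} (hR : 0 < R) :
    ∫⁻ r in Set.Ioc 0 (‖x‖ / 2), ENNReal.ofReal (r ^ (γ - N - 1)) *
        ∫⁻ y in Metric.ball x r, ENNReal.ofReal (‖y‖ ^ (-α)) * g y ≤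
      ENNReal.ofReal (2 ^ |α|) * (A * ENNReal.ofReal (1 / γ) + B * ENNReal.ofReal (1 / (a - δ))) *
        ENNReal.ofReal (‖x‖ ^ β) *
          (ENNReal.ofReal (R ^ δ) * M + ENNReal.ofReal (R ^ (δ - a)) * K) := by
  set X := ‖x‖ with hX
  have hX0 : 0 < X := norm_pos_iff.2 hx
  set c : ℝ≥0∞ := ENNReal.ofReal (2 ^ |α|) * ENNReal.ofReal (X ^ (-α)) with hc
  have hc1 : c ≠ ⊤ := ENNReal.mul_ne_top ENNReal.ofReal_ne_top ENNReal.ofReal_ne_top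
  have hball : ∀ r ∈ Set.Ioc 0 (X / 2), ∫⁻ y in Metric.ball x r, ENNReal.ofReal (‖y‖ ^ (-α)) * g y ≤
      c * ∫⁻ y in Metric.ball x r, g y := by
    intro r hr
    rw [← lintegral_const_mul' _ _ hc1]
    refine setLIntegral_mono' Metric.isOpen_ball.measurableSet fun y hy => ?_
    gcongr
    rw [hc, ← ENNReal.ofReal_mul (by positivity)]
    refine ENNReal.ofReal_le_ofReal (rpow_neg_le_of_comparable hX0 ?_ ?_)
    all_goals
      rw [Metric.mem_ball, dist_eq_norm] at hy
      have h3 := norm_sub_norm_le x y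
      have h4 := norm_sub_norm_le y x
      rw [norm_sub_rev] at h3
      have := hr.2
      linarith
  have hpow : ∀ r : ℝ, 0 < r → ∀ b : ℝ, ENNReal.ofReal (r ^ (γ - N - 1)) * ENNReal.ofReal (r ^ b) =
      ENNReal.ofReal (r ^ (γ - N - 1 + b)) := by
    intro r hr b
    rw [← ENNReal.ofReal_mul (by positivity), ← Real.rpow_add hr]
  -- `R` may exceed `‖x‖ / 2`; the range above `R` is then empty.
  set m := min R (X / 2) with hm
  have hm0 : 0 < m := lt_min hR (by positivity)
  have hsub : Set.Ioc 0 (X / 2) ⊆ Set.Ioc 0 m ∪ (Set.Ioc 0 (X / 2) ∩ Set.Ioi R) := by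
    intro r hr
    rcases le_or_gt r R with h | h
    · exact Or.inl ⟨hr.1, le_min h hr.2⟩
    · exact Or.inr ⟨hr, h⟩
  have e1 : ∫⁻ r in Set.Ioc 0 m, ENNReal.ofReal (r ^ (γ - N - 1)) *
        (∫⁻ y in Metric.ball x r, ENNReal.ofReal (‖y‖ ^ (-α)) * g y) ≤
      c * A * ENNReal.ofReal (1 / γ) * ENNReal.ofReal (X ^ (α + β)) * (ENNReal.ofReal (R ^ δ) * M) := by
    calc _ ≤ ∫⁻ r in Set.Ioc 0 m, ENNReal.ofReal (r ^ (γ - 1)) * (c * A * M) := by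
          refine setLIntegral_mono' measurableSet_Ioc fun r hr => ?_
          calc _ ≤ ENNReal.ofReal (r ^ (γ - N - 1)) * (c * (A * ENNReal.ofReal (r ^ (N : ℝ)) * M)) := by
                gcongr
                refine (hball r ⟨hr.1, hr.2.trans (min_le_right _ _)⟩).trans ?_
                gcongr
                exact h1 r hr.1
            _ = (ENNReal.ofReal (r ^ (γ - N - 1)) * ENNReal.ofReal (r ^ (N : ℝ))) * (c * A * M) := by
                ring
            _ = _ := by rw [hpow r hr.1]; congr 3; ring
      _ = ENNReal.ofReal (m ^ γ / γ) * (c * A * M) := by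
          rw [lintegral_mul_const _ (by fun_prop), lintegral_Ioc_rpow hγ hm0.le]
      _ ≤ (ENNReal.ofReal (1 / γ) * ENNReal.ofReal (X ^ (α + β)) * ENNReal.ofReal (R ^ δ)) * (c * A * M) := by
          gcongr
          rw [← ENNReal.ofReal_mul (by positivity), ← ENNReal.ofReal_mul (by positivity)]
          refine ENNReal.ofReal_le_ofReal ?_
          have hγ' : γ = (α + β) + δ := by rw [hδ]; ring
          have : m ^ γ ≤ X ^ (α + β) * R ^ δ := by
            rw [hγ', Real.rpow_add hm0]
            gcongr
            · exact (min_le_right _ _).trans (by linarith)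
            · exact min_le_left _ _
          calc m ^ γ / γ = 1 / γ * m ^ γ := by ring
            _ ≤ 1 / γ * (X ^ (α + β) * R ^ δ) := by gcongr
            _ = _ := by ring
      _ = _ := by ring
  have e2 : ∫⁻ r in Set.Ioc 0 (X / 2) ∩ Set.Ioi R, ENNReal.ofReal (r ^ (γ - N - 1)) *
        (∫⁻ y in Metric.ball x r, ENNReal.ofReal (‖y‖ ^ (-α)) * g y) ≤
      c * B * ENNReal.ofReal (1 / (a - δ)) * ENNReal.ofReal (X ^ (α + β)) *
        (ENNReal.ofReal (R ^ (δ - a)) * K) := by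
    calc _ ≤ ∫⁻ r in Set.Ioc 0 (X / 2) ∩ Set.Ioi R, ENNReal.ofReal (r ^ (-(a - δ) - 1)) *
            (c * B * ENNReal.ofReal (X ^ (α + β)) * K) := by
          refine setLIntegral_mono' (measurableSet_Ioc.inter measurableSet_Ioi) fun r hr => ?_
          have hr0 : 0 < r := hr.1.1
          calc _ ≤ ENNReal.ofReal (r ^ (γ - N - 1)) * (c * (B * ENNReal.ofReal (r ^ (N - a)) * K)) := by
                gcongr
                refine (hball r hr.1).trans ?_
                gcongr
                exact h2 r hr0
            _ = (ENNReal.ofReal (r ^ (γ - N - 1)) * ENNReal.ofReal (r ^ (N - a))) * (c * B * K) := by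
                ring
            _ ≤ (ENNReal.ofReal (r ^ (-(a - δ) - 1)) * ENNReal.ofReal (X ^ (α + β))) * (c * B * K) := by
                refine mul_le_mul' ?_ le_rfl
                rw [hpow r hr0, ← ENNReal.ofReal_mul (by positivity)]
                refine ENNReal.ofReal_le_ofReal ?_
                rw [show γ - N - 1 + (N - a) = (-(a - δ) - 1) + (α + β) by rw [hδ]; ring,
                  Real.rpow_add hr0]
                have : r ≤ X := by have := hr.1.2; linarith
                exact mul_le_mul_of_nonneg_left (Real.rpow_le_rpow hr0.le this hsum) (by positivity)
            _ = _ := by ring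
      _ ≤ ∫⁻ r in Set.Ioi R, ENNReal.ofReal (r ^ (-(a - δ) - 1)) *
            (c * B * ENNReal.ofReal (X ^ (α + β)) * K) := lintegral_mono_set Set.inter_subset_right
      _ = ENNReal.ofReal (1 / (a - δ)) * ENNReal.ofReal (R ^ (δ - a)) *
            (c * B * ENNReal.ofReal (X ^ (α + β)) * K) := by
          rw [lintegral_mul_const _ (by fun_prop), lintegral_Ioi_rpow_neg (by linarith) hR,
            ← ENNReal.ofReal_mul (by have : 0 < a - δ := by linarith
                                     positivity)]
          congr 2
          rw [neg_sub]; ring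
      _ = _ := by ring
  have hcX : c * ENNReal.ofReal (X ^ (α + β)) = ENNReal.ofReal (2 ^ |α|) * ENNReal.ofReal (X ^ β) := by
    rw [hc, mul_assoc, ← ENNReal.ofReal_mul (by positivity), ← Real.rpow_add hX0]
    congr 3; ring
  calc _ ≤ _ := lintegral_mono_set hsub
    _ ≤ _ := lintegral_union_le _ _ _
    _ ≤ _ := add_le_add e1 e2
    _ = (c * ENNReal.ofReal (X ^ (α + β))) * (A * ENNReal.ofReal (1 / γ) * (ENNReal.ofReal (R ^ δ) * M)
        + B * ENNReal.ofReal (1 / (a - δ)) * (ENNReal.ofReal (R ^ (δ - a)) * K)) := by ring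
    _ ≤ (c * ENNReal.ofReal (X ^ (α + β))) *
        ((A * ENNReal.ofReal (1 / γ) + B * ENNReal.ofReal (1 / (a - δ))) * (ENNReal.ofReal (R ^ δ) * M)
        + (A * ENNReal.ofReal (1 / γ) + B * ENNReal.ofReal (1 / (a - δ))) *
          (ENNReal.ofReal (R ^ (δ - a)) * K)) := by
        gcongr
        · exact le_self_add
        · exact le_add_self
    _ = _ := by rw [hcX]; ring

/-- Hedberg's optimisation over the cut. The degenerate values are separate: for `M = ⊤` the right
side is infinite, and for `M = 0` one lets `R → ∞`. -/
lemma le_rpow_mul_rpow_of_forall_scale {δ a : ℝ} (hδ : 0 ≤ δ) (hδa : δ < a) {X C M K : ℝ≥0∞}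
    (hC : C ≠ ⊤) (hC0 : C ≠ 0) (hK0 : K ≠ 0) (hK : K ≠ ⊤)
    (h : ∀ R : ℝ, 0 < R →
      X ≤ C * (ENNReal.ofReal (R ^ δ) * M + ENNReal.ofReal (R ^ (δ - a)) * K)) :
    X ≤ 2 * C * (M ^ (1 - δ / a) * K ^ (δ / a)) := by
  have ha : 0 < a := by linarith
  have hθ : 0 < 1 - δ / a := by rw [sub_pos, div_lt_one ha]; exact hδa
  have hθ' : 0 ≤ δ / a := by positivity
  rcases eq_or_ne M ⊤ with rfl | hM
  · rw [ENNReal.top_rpow_of_pos hθ, ENNReal.top_mul, ENNReal.mul_top]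
    · exact le_top
    · exact mul_ne_zero two_ne_zero hC0
    · exact (ENNReal.rpow_pos (pos_iff_ne_zero.2 hK0) hK).ne'
  rcases eq_or_ne M 0 with rfl | hM0
  · rw [ENNReal.zero_rpow_of_pos hθ, zero_mul, mul_zero]
    have hlim : Filter.Tendsto (fun R : ℝ => C * (ENNReal.ofReal (R ^ (-(a - δ))) * K)) Filter.atTop
        (nhds (C * (ENNReal.ofReal 0 * K))) := by
      refine ENNReal.Tendsto.const_mul (ENNReal.Tendsto.mul_const ?_ (Or.inr hK)) (Or.inr hC)
      exact ENNReal.tendsto_ofReal (tendsto_rpow_neg_atTop (by linarith))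
    simp only [ENNReal.ofReal_zero, zero_mul, mul_zero] at hlim
    refine ge_of_tendsto hlim ?_
    filter_upwards [Filter.eventually_gt_atTop 0] with R hR
    have := h R hR
    rwa [mul_zero, zero_add, ← neg_sub] at this
  · have hm : 0 < M.toReal := ENNReal.toReal_pos hM0 hM
    have hk : 0 < K.toReal := ENNReal.toReal_pos hK0 hK
    -- This scale makes the two terms equal, whence the factor `2` in the conclusion.
    have key := h ((K.toReal / M.toReal) ^ (1 / a)) (by positivity)
    set m := M.toReal
    set k := K.toReal
    have hMm : M = ENNReal.ofReal m := (ENNReal.ofReal_toReal hM).symm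
    have hKk : K = ENNReal.ofReal k := (ENNReal.ofReal_toReal hK).symm
    have r1 : ((k / m) ^ (1 / a)) ^ δ * m = m ^ (1 - δ / a) * k ^ (δ / a) := by
      rw [← Real.rpow_mul (by positivity), Real.div_rpow hk.le hm.le, Real.rpow_sub hm, Real.rpow_one,
        show 1 / a * δ = δ / a by ring]
      field_simp
    have r2 : ((k / m) ^ (1 / a)) ^ (δ - a) * k = m ^ (1 - δ / a) * k ^ (δ / a) := by
      rw [← Real.rpow_mul (by positivity), Real.div_rpow hk.le hm.le, Real.rpow_sub hm, Real.rpow_one,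
        show 1 / a * (δ - a) = δ / a - 1 by field_simp, Real.rpow_sub hm, Real.rpow_sub hk,
        Real.rpow_one, Real.rpow_one]
      field_simp
    refine key.trans (le_of_eq ?_)
    rw [hMm, hKk, ← ENNReal.ofReal_mul (by positivity), ← ENNReal.ofReal_mul (by positivity), r1, r2,
      ENNReal.ofReal_rpow_of_pos hm, ENNReal.ofReal_rpow_of_pos hk,
      ← ENNReal.ofReal_mul (by positivity)]
    ring

/-- The relation defining `q` in the two forms needed: `a - δ = (N - lam) / q` is the decay of the
far part, and `1 - δ / a = p / q` is the exponent in Hedberg's inequality. -/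
lemma HardySobolevAdmissible.exponents {N : ℕ} {γ α β p q lam : ℝ} (hγ : 0 < γ)
    (h : HardySobolevAdmissible N γ α β p q lam) :
    0 < N ∧ 0 < q ∧ lam < N ∧ (N - lam) / p - (γ - α - β) = (N - lam) / q ∧
      1 - (γ - α - β) / ((N - lam) / p) = p / q ∧ p ≤ q := by
  have hp : 0 < p := zero_lt_one.trans h.one_lt_p
  have hδ : 0 ≤ γ - α - β := by linarith [h.sum_le]
  have h1 : lam < N - (γ - α - β) * p := lt_of_lt_of_le h.lam_lt (min_le_right _ _)
  have hlN : 0 < N - lam := by nlinarith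
  have hqe := h.q_eq
  have hq' : 0 < 1 / q := by
    rw [hqe, sub_pos, div_lt_div_iff₀ hlN hp]
    linarith
  have hq : 0 < q := by simpa using hq'
  have hN : (0 : ℝ) < N := hγ.trans h.order_lt
  refine ⟨by exact_mod_cast hN, hq, by linarith, ?_, ?_, ?_⟩
  · have : (N - lam) / q = (N - lam) * (1 / q) := by ring
    rw [this, hqe]
    field_simp
  · have : p / q = p * (1 / q) := by ring
    rw [this, hqe]
    field_simp
  · have : 1 / q ≤ 1 / p := by
      rw [hqe]; have : 0 ≤ (γ - α - β) / (N - lam) := by positivity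
      linarith
    exact (one_div_le_one_div hq hp).1 this

/-- For `r > ‖x‖ / 2` the ball `B(x, r)` lies in `B(0, 3r)`, so only the growth of the mass around
the origin matters. The resulting integrand `r^(-(a - δ - β) - 1)` is integrable at infinity because
`β < a - δ`. -/
lemma lintegral_far_le {N : ℕ} {γ α β δ a : ℝ} (hδ : δ = γ - α - β) (hβ : β < a - δ) {B : ℝ≥0}
    {f : EuclideanSpace ℝ (Fin N) → ℝ≥0∞} {K : ℝ≥0∞}
    (hB : ∀ R : ℝ, 0 < R → ∫⁻ y in Metric.ball 0 R, f y ≤ B * ENNReal.ofReal (R ^ (N - α - a)) * K)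
    {x : EuclideanSpace ℝ (Fin N)} (hx : x ≠ 0) :
    ∫⁻ r in Set.Ioi (‖x‖ / 2), ENNReal.ofReal (r ^ (γ - N - 1)) * ∫⁻ y in Metric.ball x r, f y ≤
      B * ENNReal.ofReal (3 ^ (N - α - a) * (1 / 2) ^ (β - (a - δ)) / (a - δ - β)) *
        ENNReal.ofReal (‖x‖ ^ (β - (a - δ))) * K := by
  set X := ‖x‖ with hX
  have hX0 : 0 < X := norm_pos_iff.2 hx
  calc _ ≤ ∫⁻ r in Set.Ioi (X / 2), ENNReal.ofReal (r ^ (-(a - δ - β) - 1)) *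
        (B * ENNReal.ofReal (3 ^ (N - α - a)) * K) := by
        refine setLIntegral_mono' measurableSet_Ioi fun r (hr : X / 2 < r) => ?_
        have hr0 : 0 < r := by linarith
        calc _ ≤ ENNReal.ofReal (r ^ (γ - N - 1)) *
              (B * ENNReal.ofReal ((3 * r) ^ (N - α - a)) * K) := by
              gcongr
              refine le_trans (lintegral_mono_set (Metric.ball_subset_ball' ?_)) (hB (3 * r) (by positivity))
              rw [dist_zero_right]; linarith
          _ = (ENNReal.ofReal (r ^ (γ - N - 1)) * ENNReal.ofReal (r ^ (N - α - a))) *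
              (B * ENNReal.ofReal (3 ^ (N - α - a)) * K) := by
              rw [Real.mul_rpow (by norm_num) hr0.le, ENNReal.ofReal_mul (by positivity)]
              ring
          _ = _ := by
              rw [← ENNReal.ofReal_mul (by positivity), ← Real.rpow_add hr0]
              congr 3
              rw [hδ]; ring
    _ = ENNReal.ofReal ((X / 2) ^ (-(a - δ - β)) / (a - δ - β)) *
        (B * ENNReal.ofReal (3 ^ (N - α - a)) * K) := by
        rw [lintegral_mul_const _ (by fun_prop), lintegral_Ioi_rpow_neg (by linarith) (by positivity)]
    _ = B * (ENNReal.ofReal (3 ^ (N - α - a)) * ENNReal.ofReal ((X / 2) ^ (-(a - δ - β)) / (a - δ - β)))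
        * K := by ring
    _ = _ := by
        have h0 : 0 < a - δ - β := by linarith
        rw [mul_assoc (B : ℝ≥0∞) (ENNReal.ofReal _) (ENNReal.ofReal _), ← ENNReal.ofReal_mul (by positivity),
          ← ENNReal.ofReal_mul (by positivity)]
        congr 3
        rw [show X / 2 = (1 / 2) * X by ring, Real.mul_rpow (by norm_num) hX0.le,
          show β - (a - δ) = -(a - δ - β) by ring]
        ring

/-- The pointwise Hedberg inequality with weights: the first term comes from the far scales, the
second from the near scales after optimising the cut. The factor `‖x‖^(-β)` cancels the `‖x‖^β` of
both parts. -/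
lemma scalePotential_weighted_le {N : ℕ} {γ α β p q lam : ℝ} (hγ : 0 < γ)
    (h : HardySobolevAdmissible N γ α β p q lam) :
    ∃ C : ℝ≥0, ∀ (K : ℝ≥0∞) (g : EuclideanSpace ℝ (Fin N) → ℝ≥0∞), Measurable g → K ≠ 0 → K ≠ ⊤ →
      MorreyBound p lam K g → ∀ x : EuclideanSpace ℝ (Fin N), x ≠ 0 →
        ENNReal.ofReal (‖x‖ ^ (-β)) *
            scalePotential γ (fun y => ENNReal.ofReal (‖y‖ ^ (-α)) * g y) x ≤
          C * (ENNReal.ofReal (‖x‖ ^ (-((N - lam) / q))) * K +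
            dyadicMaximal g x ^ (p / q) * K ^ (1 - p / q)) := by
  obtain ⟨hN, hq, hlN, ha, hθ, hpq⟩ := h.exponents hγ
  set δ := γ - α - β with hδ
  set a := (N - lam) / p with had
  obtain ⟨B₁, hB₁⟩ := MorreyBound.lintegral_ball_zero_le hN (lam := lam) h.one_lt_p h.alpha_lt
  obtain ⟨B₂, hB₂⟩ := MorreyBound.lintegral_ball_le (N := N) (lam := lam) h.one_lt_p
  have hδ0 : 0 ≤ δ := by rw [hδ]; linarith [h.sum_le]
  have hδa : δ < a := by
    have : 0 < (N - lam) / q := div_pos (by linarith) hq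
    linarith
  have hβ : β < a - δ := by rw [ha]; exact h.beta_lt
  set D : ℝ≥0 := Real.toNNReal (2 ^ |α|) *
    (2 ^ N * Real.toNNReal (1 / γ) + B₂ * Real.toNNReal (1 / (a - δ))) with hD
  set D' : ℝ≥0 := B₁ * Real.toNNReal (3 ^ (N - α - a) * (1 / 2) ^ (β - (a - δ)) / (a - δ - β)) with hD'
  refine ⟨D' + 2 * D, fun K g hg hK0 hK hb x hx => ?_⟩
  have hX0 : 0 < ‖x‖ := norm_pos_iff.2 hx
  have hD0 : (D : ℝ≥0∞) ≠ 0 := by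
    have : 0 < D := by
      rw [hD]
      have : 0 < Real.toNNReal (1 / γ) := Real.toNNReal_pos.2 (by positivity)
      have : 0 < Real.toNNReal (2 ^ |α|) := Real.toNNReal_pos.2 (by positivity)
      positivity
    exact_mod_cast this.ne'
  set f : EuclideanSpace ℝ (Fin N) → ℝ≥0∞ := fun y => ENNReal.ofReal (‖y‖ ^ (-α)) * g y with hf
  have hsplit : scalePotential γ f x =
      (∫⁻ r in Set.Ioc 0 (‖x‖ / 2), ENNReal.ofReal (r ^ (γ - N - 1)) * ∫⁻ y in Metric.ball x r, f y) +
      ∫⁻ r in Set.Ioi (‖x‖ / 2), ENNReal.ofReal (r ^ (γ - N - 1)) * ∫⁻ y in Metric.ball x r, f y := by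
    rw [scalePotential, ← Set.Ioc_union_Ioi_eq_Ioi (by positivity : (0 : ℝ) ≤ ‖x‖ / 2),
      lintegral_union measurableSet_Ioi Set.Ioc_disjoint_Ioi_same]
  have far := lintegral_far_le (γ := γ) hδ hβ (f := f) (fun R hR => hB₁ K g hg hb R hR) hx
  have near : ∀ R : ℝ, 0 < R → ENNReal.ofReal (‖x‖ ^ (-β)) * ∫⁻ r in Set.Ioc 0 (‖x‖ / 2),
      ENNReal.ofReal (r ^ (γ - N - 1)) * (∫⁻ y in Metric.ball x r, f y) ≤
      D * (ENNReal.ofReal (R ^ δ) * dyadicMaximal g x + ENNReal.ofReal (R ^ (δ - a)) * K) := by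
    intro R hR
    have h1 := lintegral_near_le (A := 2 ^ N) (B := B₂) (g := g) (M := dyadicMaximal g x) (K := K)
      hγ h.sum_nonneg hδ hδ0 hδa hx (fun r hr => by
        refine (lintegral_ball_le_dyadicMaximal g x hr).trans (le_of_eq ?_)
        rw [ENNReal.ofReal_mul (by positivity)]
        simp [ENNReal.ofReal_pow]) (fun r hr => hB₂ K g hg hb x r hr) hR
    calc _ ≤ ENNReal.ofReal (‖x‖ ^ (-β)) * _ := mul_le_mul' le_rfl h1
      _ = (ENNReal.ofReal (‖x‖ ^ β) * ENNReal.ofReal (‖x‖ ^ (-β))) * (D *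
          (ENNReal.ofReal (R ^ δ) * dyadicMaximal g x + ENNReal.ofReal (R ^ (δ - a)) * K)) := by
          rw [hD]
          push_cast
          simp only [ENNReal.ofReal]
          ring
      _ = _ := by rw [ofReal_mul_ofReal_rpow_neg hX0, one_mul]
  have near' := le_rpow_mul_rpow_of_forall_scale hδ0 hδa ENNReal.coe_ne_top hD0 hK0 hK near
  rw [hθ, show δ / a = 1 - p / q by rw [← hθ]; ring] at near'
  rw [hsplit, mul_add, add_comm]
  calc _ ≤ D' * (ENNReal.ofReal (‖x‖ ^ (-((N - lam) / q))) * K) +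
        2 * D * (dyadicMaximal g x ^ (p / q) * K ^ (1 - p / q)) := by
        refine add_le_add ?_ near'
        calc _ ≤ ENNReal.ofReal (‖x‖ ^ (-β)) * _ := mul_le_mul' le_rfl far
          _ = D' * (ENNReal.ofReal (‖x‖ ^ (-β)) * ENNReal.ofReal (‖x‖ ^ (β - (a - δ))) * K) := by
              rw [hD']
              push_cast
              simp only [ENNReal.ofReal]
              ring
          _ = _ := by
              rw [← ENNReal.ofReal_mul (by positivity), ← Real.rpow_add hX0, ← ha]
              congr 4
              ring
    _ ≤ _ := by
        push_cast
        rw [mul_add]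
        gcongr
        · exact le_self_add
        · exact le_add_self

/-- The Stein–Weiss inequality in Morrey spaces for the potential of order `γ`. -/
theorem scalePotential_morreyBound {N : ℕ} {γ α β p q lam : ℝ} (hγ : 0 < γ)
    (h : HardySobolevAdmissible N γ α β p q lam) :
    ∃ C : ℝ≥0, ∀ (K : ℝ≥0∞) (f : EuclideanSpace ℝ (Fin N) → ℝ≥0∞), Measurable f → K ≠ 0 → K ≠ ⊤ →
      MorreyBound p lam K (fun x => ENNReal.ofReal (‖x‖ ^ α) * f x) →
        MorreyBound q lam (C * K) (fun x => ENNReal.ofReal (‖x‖ ^ (-β)) * scalePotential γ f x) := by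
  obtain ⟨hN, hq, hlN, ha, hθ, hpq⟩ := h.exponents hγ
  have hp := h.one_lt_p
  have hp0 : 0 < p := by linarith
  obtain ⟨A, hA⟩ := scalePotential_weighted_le hγ h
  obtain ⟨B, hB⟩ := MorreyBound.maximal hN h.one_lt_p hlN.le
  obtain ⟨D, hD⟩ := lintegral_ball_norm_rpow_le hN h.lam_pos hlN.le
  set C : ℝ≥0 := A ^ q * (2 ^ (q - 1) * (D + B ^ p)) with hC
  refine ⟨C ^ (1 / q), fun K f hf hK0 hK hb x r hr => ?_⟩
  have hCK : ((C ^ (1 / q) : ℝ≥0) * K : ℝ≥0∞) ^ q = C * K ^ q := by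
    rw [ENNReal.mul_rpow_of_nonneg _ _ hq.le, ← ENNReal.coe_rpow_of_nonneg _ hq.le,
      ← NNReal.rpow_mul, one_div_mul_cancel hq.ne', NNReal.rpow_one]
  rw [hCK]
  set g : EuclideanSpace ℝ (Fin N) → ℝ≥0∞ := fun x => ENNReal.ofReal (‖x‖ ^ α) * f x with hg
  have hgm : Measurable g := by
    have : Measurable fun x : EuclideanSpace ℝ (Fin N) => ‖x‖ ^ α := measurable_norm.pow_const _
    exact this.ennreal_ofReal.mul hf
  have : Nonempty (Fin N) := ⟨⟨0, hN⟩⟩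
  have hne : ∀ᵐ x : EuclideanSpace ℝ (Fin N), x ≠ 0 := by
    simp [ae_iff]
  have hfg : f =ᵐ[volume] fun y => ENNReal.ofReal (‖y‖ ^ (-α)) * g y := by
    filter_upwards [hne] with y hy
    rw [hg, ← mul_assoc, mul_comm (ENNReal.ofReal _) (ENNReal.ofReal _),
      ofReal_mul_ofReal_rpow_neg (norm_pos_iff.2 hy), one_mul]
  rw [scalePotential_congr γ hfg]
  have hfin : (2 : ℝ≥0∞) ^ (q - 1) ≠ ⊤ := ENNReal.rpow_ne_top_of_nonneg (by linarith) (by simp)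
  have hmeas1 : Measurable fun y : EuclideanSpace ℝ (Fin N) => ENNReal.ofReal (‖y‖ ^ (-(N - lam))) := by
    have : Measurable fun x : EuclideanSpace ℝ (Fin N) => ‖x‖ ^ (-(N - lam)) :=
      measurable_norm.pow_const _
    exact this.ennreal_ofReal
  -- Raising the pointwise bound to the power `q` turns its two terms into `‖y‖^(-(N - lam)) K^q`
  -- and `(M g)^p K^(q - p)`, each of which has mass `O(r^lam)` times `K^q` on a ball of radius `r`.
  calc _ ≤ ∫⁻ y in Metric.ball x r, (A : ℝ≥0∞) ^ q * (2 ^ (q - 1) *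
        (ENNReal.ofReal (‖y‖ ^ (-(N - lam))) * K ^ q + dyadicMaximal g y ^ p * K ^ (q - p))) := by
        refine lintegral_mono_ae (ae_restrict_of_ae ?_)
        filter_upwards [hne] with y hy
        calc _ ≤ (A * (ENNReal.ofReal (‖y‖ ^ (-((N - lam) / q))) * K +
              dyadicMaximal g y ^ (p / q) * K ^ (1 - p / q))) ^ q := by
              exact ENNReal.rpow_le_rpow (hA K g hgm hK0 hK hb y hy) hq.le
          _ ≤ (A : ℝ≥0∞) ^ q * (2 ^ (q - 1) * ((ENNReal.ofReal (‖y‖ ^ (-((N - lam) / q))) * K) ^ q +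
              (dyadicMaximal g y ^ (p / q) * K ^ (1 - p / q)) ^ q)) := by
              rw [ENNReal.mul_rpow_of_nonneg _ _ hq.le]
              gcongr
              exact ENNReal.rpow_add_le_mul_rpow_add_rpow _ _ (by linarith)
          _ = _ := by
              rw [ENNReal.mul_rpow_of_nonneg _ _ hq.le, ENNReal.mul_rpow_of_nonneg _ _ hq.le,
                ENNReal.ofReal_rpow_of_nonneg (by positivity) hq.le, ← Real.rpow_mul (norm_nonneg _),
                ← ENNReal.rpow_mul, ← ENNReal.rpow_mul]
              congr 6
              · field_simp
              · field_simp
              · field_simp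
    _ = (A : ℝ≥0∞) ^ q * (2 ^ (q - 1) *
        ((∫⁻ y in Metric.ball x r, ENNReal.ofReal (‖y‖ ^ (-(N - lam)))) * K ^ q +
          (∫⁻ y in Metric.ball x r, dyadicMaximal g y ^ p) * K ^ (q - p))) := by
        rw [lintegral_const_mul' _ _ (ENNReal.rpow_ne_top_of_nonneg hq.le ENNReal.coe_ne_top),
          lintegral_const_mul' _ _ hfin, lintegral_add_left (hmeas1.mul_const _),
          lintegral_mul_const _ hmeas1, lintegral_mul_const _ ((measurable_dyadicMaximal hgm).pow_const _)]
    _ ≤ (A : ℝ≥0∞) ^ q * (2 ^ (q - 1) *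
        ((D * ENNReal.ofReal (r ^ lam)) * K ^ q +
          (ENNReal.ofReal (r ^ lam) * (B * K) ^ p) * K ^ (q - p))) := by
        gcongr
        · exact hD x r hr
        · exact hB K g hgm hb x r hr
    _ = _ := by
        have : K ^ q = K ^ p * K ^ (q - p) := by
          rw [← ENNReal.rpow_add _ _ hK0 hK]; congr 1; ring
        rw [hC, ENNReal.mul_rpow_of_nonneg _ _ hp0.le, mul_assoc (ENNReal.ofReal _), mul_assoc _ (K ^ p),
          ← this]
        push_cast
        rw [ENNReal.coe_rpow_of_nonneg _ hq.le, ENNReal.coe_rpow_of_nonneg _ hp0.le,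
          ENNReal.coe_rpow_of_nonneg _ (by linarith)]
        push_cast
        ring

/-! ### Weakly differentiable functions and the potential of their gradient -/

lemma hasCompactSupport_comp_dilation {N : ℕ} {F : Type*} [Zero F]
    {e : EuclideanSpace ℝ (Fin N) → F} (hs : ∀ z, 1 ≤ ‖z‖ → e z = 0) (x : EuclideanSpace ℝ (Fin N))
    {r : ℝ} (hr : 0 < r) : HasCompactSupport fun y => e (r⁻¹ • (y - x)) := by
  refine HasCompactSupport.intro (isCompact_closedBall x r) fun y hy => hs _ ?_
  rw [Metric.mem_closedBall, dist_eq_norm, not_le] at hy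
  rw [norm_smul, norm_inv, Real.norm_of_nonneg hr.le, le_inv_mul_iff₀ hr]
  linarith

/-- The weak gradient identity tested against the vector field `y ↦ e((y - x) / r) (y - x)`. -/
lemma IsWeakGradient.integral_radial {N : ℕ} {u : EuclideanSpace ℝ (Fin N) → ℝ}
    {G : EuclideanSpace ℝ (Fin N) → EuclideanSpace ℝ (Fin N)} (h : IsWeakGradient u G)
    {e : EuclideanSpace ℝ (Fin N) → ℝ} (he : ContDiff ℝ ∞ e) (hs : ∀ z, 1 ≤ ‖z‖ → e z = 0)
    (x : EuclideanSpace ℝ (Fin N)) {r : ℝ} (hr : 0 < r) :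
    ∫ y, u y * (N * e (r⁻¹ • (y - x)) + fderiv ℝ e (r⁻¹ • (y - x)) (r⁻¹ • (y - x))) =
      -∫ y, e (r⁻¹ • (y - x)) * inner ℝ (G y) (y - x) := by
  set b := EuclideanSpace.basisFun (Fin N) ℝ with hb
  -- These are the components of the vector field. Its divergence at `y` is `N e(z) + De(z) z` with
  -- `z = (y - x) / r`, the same expression that appears in the `r`-derivative of the dilated
  -- kernel.
  set φ : Fin N → EuclideanSpace ℝ (Fin N) → ℝ := fun i y => (y - x) i * e (r⁻¹ • (y - x)) with hφ
  have hφd : ∀ i, ContDiff ℝ ∞ (φ i) := by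
    intro i
    refine ContDiff.mul ?_ (he.comp (by fun_prop))
    exact (EuclideanSpace.proj (𝕜 := ℝ) i).contDiff.comp (contDiff_id.sub contDiff_const)
  have hφc : ∀ i, HasCompactSupport (φ i) := fun i =>
    (hasCompactSupport_comp_dilation hs x hr).mul_left
  have hder : ∀ i y, fderiv ℝ (φ i) y (b i) = e (r⁻¹ • (y - x)) +
      (r⁻¹ • (y - x)) i * fderiv ℝ e (r⁻¹ • (y - x)) (b i) := by
    intro i y
    have h1 : HasFDerivAt (fun y : EuclideanSpace ℝ (Fin N) => (y - x) i)
        (EuclideanSpace.proj (𝕜 := ℝ) i : EuclideanSpace ℝ (Fin N) →L[ℝ] ℝ) y :=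
      (EuclideanSpace.proj (𝕜 := ℝ) i : EuclideanSpace ℝ (Fin N) →L[ℝ] ℝ).hasFDerivAt.comp y
        ((hasFDerivAt_id y).sub_const x)
    have h2 : HasFDerivAt (fun y : EuclideanSpace ℝ (Fin N) => e (r⁻¹ • (y - x)))
        ((fderiv ℝ e (r⁻¹ • (y - x))).comp (r⁻¹ • ContinuousLinearMap.id ℝ _)) y := by
      have h3 := (he.differentiable (by simp) (r⁻¹ • (y - x))).hasFDerivAt
      exact h3.comp y (((hasFDerivAt_id y).sub_const x).const_smul r⁻¹)
    have h3 : HasFDerivAt (φ i) _ y := h1.mul h2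
    rw [h3.fderiv]
    simp [hb]
    ring
  have hcong : ∀ y, u y * (N * e (r⁻¹ • (y - x)) + fderiv ℝ e (r⁻¹ • (y - x)) (r⁻¹ • (y - x))) =
      ∑ i, u y * fderiv ℝ (φ i) y (b i) := by
    intro y
    rw [← Finset.mul_sum]
    congr 1
    simp_rw [hder]
    rw [Finset.sum_add_distrib]
    simp only [Finset.sum_const, Finset.card_univ, Fintype.card_fin, nsmul_eq_mul]
    congr 1
    have hlin : ∀ (L : EuclideanSpace ℝ (Fin N) →L[ℝ] ℝ) (z : EuclideanSpace ℝ (Fin N)),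
        L z = ∑ i, z i * L (b i) := by
      intro L z
      conv_lhs => rw [← b.sum_repr z, map_sum]
      simp [hb]
    exact hlin _ _
  have hcong2 : ∀ y, e (r⁻¹ • (y - x)) * inner ℝ (G y) (y - x) =
      ∑ i, φ i y * inner ℝ (G y) (b i) := by
    intro y
    rw [PiLp.inner_apply, Finset.mul_sum]
    congr 1 with i
    simp [hφ, hb, EuclideanSpace.inner_single_right]
    ring
  simp_rw [hcong, hcong2]
  rw [integral_finsetSum, integral_finsetSum, ← Finset.sum_neg_distrib]
  · exact Finset.sum_congr rfl fun i _ => h.integral_eq (φ i) (hφd i) (hφc i) (b i)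
  · intro i _
    have hc : Continuous fun y => φ i y • b i := (hφd i).continuous.smul continuous_const
    have := (h.locallyIntegrable_grad.integrable_smul_left_of_hasCompactSupport
      (hφd i).continuous (hφc i)).inner_const (𝕜 := ℝ) (b i)
    refine this.congr (Filter.Eventually.of_forall fun y => ?_)
    simp [inner_smul_left]
  · intro i _
    have h1 : Continuous fun y => fderiv ℝ (φ i) y (b i) :=
      ((hφd i).continuous_fderiv (by simp)).clm_apply continuous_const
    have h2 : HasCompactSupport fun y => fderiv ℝ (φ i) y (b i) :=
      (hφc i).fderiv_apply (𝕜 := ℝ) (b i)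
    have := h.locallyIntegrable.integrable_smul_left_of_hasCompactSupport h1 h2
    refine this.congr (Filter.Eventually.of_forall fun y => ?_)
    simp [mul_comm]

/-- The derivative in `r` of the dilated kernel `r^{-N} e((y - x) / r)`. -/
lemma hasDerivAt_dilation {N : ℕ} {e : EuclideanSpace ℝ (Fin N) → ℝ} (he : ContDiff ℝ ∞ e)
    (w : EuclideanSpace ℝ (Fin N)) {r : ℝ} (hr : 0 < r) :
    HasDerivAt (fun r : ℝ => r ^ (-(N : ℝ)) * e (r⁻¹ • w))
      (-(r ^ (-(N : ℝ) - 1) * (N * e (r⁻¹ • w) + fderiv ℝ e (r⁻¹ • w) (r⁻¹ • w)))) r := by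
  have h1 : HasDerivAt (fun r : ℝ => r ^ (-(N : ℝ))) (-(N : ℝ) * r ^ (-(N : ℝ) - 1)) r :=
    Real.hasDerivAt_rpow_const (Or.inl hr.ne')
  have h2 : HasDerivAt (fun r : ℝ => r⁻¹ • w) ((-(r ^ 2)⁻¹) • w) r :=
    (hasDerivAt_inv hr.ne').smul_const w
  have h3 : HasDerivAt (fun r : ℝ => e (r⁻¹ • w)) _ r := ((he.differentiable (by simp) (r⁻¹ • w)).hasFDerivAt.comp_hasDerivAt r h2)
  have h5 : HasDerivAt (fun r : ℝ => r ^ (-(N : ℝ)) * e (r⁻¹ • w)) _ r := h1.mul h3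
  refine h5.congr_deriv ?_
  have h4 : (-(r ^ 2)⁻¹) • w = (-r⁻¹) • (r⁻¹ • w) := by
    rw [smul_smul]; congr 1; field_simp
  rw [h4, map_smul, Real.rpow_sub_one hr.ne', smul_eq_mul]
  ring

/-- The `r`-derivative of `r^(-N) e((y - x) / r)` is `-r^(-N - 1)` times the divergence of `e((y -
x) / r) (y - x)`. One integrates it over `(ε, R]`, exchanges the integrals, and moves the divergence
onto `G` by `IsWeakGradient.integral_radial`. -/
lemma integral_dilation_sub_eq {N : ℕ} {u : EuclideanSpace ℝ (Fin N) → ℝ}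
    {G : EuclideanSpace ℝ (Fin N) → EuclideanSpace ℝ (Fin N)} (h : IsWeakGradient u G)
    {e : EuclideanSpace ℝ (Fin N) → ℝ} (he : ContDiff ℝ ∞ e) (hs : ∀ z, 1 ≤ ‖z‖ → e z = 0)
    (x : EuclideanSpace ℝ (Fin N)) {ε R : ℝ} (hε : 0 < ε) (hR : ε ≤ R) :
    (∫ y, u y * (R ^ (-(N : ℝ)) * e (R⁻¹ • (y - x)))) -
        ∫ y, u y * (ε ^ (-(N : ℝ)) * e (ε⁻¹ • (y - x))) =
      ∫ r in Set.Ioc ε R, r ^ (-(N : ℝ) - 1) * ∫ y, e (r⁻¹ • (y - x)) * inner ℝ (G y) (y - x) := by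
  set H : EuclideanSpace ℝ (Fin N) → ℝ := fun z => N * e z + fderiv ℝ e z z with hH
  have hHc : Continuous H :=
    (continuous_const.mul he.continuous).add
      ((he.continuous_fderiv (by simp)).clm_apply continuous_id)
  have hHs : ∀ z, 1 < ‖z‖ → H z = 0 := by
    intro z hz
    have h1 : e =ᶠ[nhds z] fun _ => 0 := by
      filter_upwards [(isOpen_lt continuous_const continuous_norm).mem_nhds hz] with y hy
      exact hs y (le_of_lt hy)
    simp [hH, h1.fderiv_eq, h1.eq_of_nhds]
  have hHcs : HasCompactSupport H :=
    HasCompactSupport.intro (isCompact_closedBall 0 1) fun z hz => hHs z (by simpa using hz)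
  obtain ⟨B, hB⟩ := hHc.bounded_above_of_compact_support hHcs
  have hB0 : 0 ≤ B := (norm_nonneg _).trans (hB 0)
  set k : ℝ → EuclideanSpace ℝ (Fin N) → ℝ := fun r y => -(r ^ (-(N : ℝ) - 1) * H (r⁻¹ • (y - x)))
    with hk
  have hint : ∀ y, ∫ r in Set.Ioc ε R, u y * k r y =
      u y * (R ^ (-(N : ℝ)) * e (R⁻¹ • (y - x))) - u y * (ε ^ (-(N : ℝ)) * e (ε⁻¹ • (y - x))) := by
    intro y
    rw [integral_const_mul, ← intervalIntegral.integral_of_le hR, ← mul_sub]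
    congr 1
    refine intervalIntegral.integral_eq_sub_of_hasDerivAt
      (f := fun r => r ^ (-(N : ℝ)) * e (r⁻¹ • (y - x))) (fun r hr => ?_) ?_
    · rw [Set.uIcc_of_le hR] at hr
      exact hasDerivAt_dilation he (y - x) (hε.trans_le hr.1)
    · refine ContinuousOn.intervalIntegrable ?_
      rw [Set.uIcc_of_le hR]
      have h0 : ∀ r ∈ Set.Icc ε R, r ≠ 0 := fun r hr => (hε.trans_le hr.1).ne'
      refine ((ContinuousOn.rpow_const continuousOn_id fun r hr => Or.inl (h0 r hr)).mul ?_).neg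
      refine hHc.comp_continuousOn ?_
      exact (continuousOn_id.inv₀ h0).smul continuousOn_const
  have hIu := h.locallyIntegrable.integrableOn_isCompact (isCompact_closedBall x R)
  have hprod : Integrable (Function.uncurry fun r y => u y * k r y)
      ((volume.restrict (Set.Ioc ε R)).prod volume) := by
    -- On `(ε, R]` the kernel is at most `ε^(-N - 1) B` and is supported in the closed ball of
    -- radius `R`, where `u` is integrable.
    have hdom : Integrable (fun z : ℝ × EuclideanSpace ℝ (Fin N) => (ε ^ (-(N : ℝ) - 1) * B) *
        (Metric.closedBall x R).indicator (fun y => ‖u y‖) z.2)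
        ((volume.restrict (Set.Ioc ε R)).prod volume) := by
      refine Integrable.mul_prod (f := fun _ : ℝ => ε ^ (-(N : ℝ) - 1) * B)
        (g := (Metric.closedBall x R).indicator (fun y => ‖u y‖)) ?_ ?_
      · exact integrable_const _
      · exact (integrable_indicator_iff Metric.isClosed_closedBall.measurableSet).2 hIu.norm
    refine hdom.mono' ?_ ?_
    · refine AEStronglyMeasurable.mul ?_ ?_
      · exact h.locallyIntegrable.aestronglyMeasurable.comp_snd
      · refine Measurable.aestronglyMeasurable ?_
        refine Measurable.neg (Measurable.mul (by fun_prop) ?_)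
        exact hHc.measurable.comp (by fun_prop)
    · have hmem : ∀ᵐ z ∂((volume.restrict (Set.Ioc ε R)).prod
          (volume : Measure (EuclideanSpace ℝ (Fin N)))), z.1 ∈ Set.Ioc ε R :=
        Measure.quasiMeasurePreserving_fst.ae (ae_restrict_mem measurableSet_Ioc)
      filter_upwards [hmem] with z hz
      have hr0 : 0 < z.1 := hε.trans hz.1
      simp only [Function.uncurry, hk, norm_mul, norm_neg]
      by_cases hy : z.2 ∈ Metric.closedBall x R
      · rw [Set.indicator_of_mem hy, mul_comm ‖u z.2‖]
        gcongr
        · rw [Real.norm_of_nonneg (by positivity)]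
          exact Real.rpow_le_rpow_of_nonpos hε hz.1.le (by have : (0:ℝ) ≤ N := by positivity
                                                           linarith)
        · exact hB _
      · rw [hHs]
        · simp [Set.indicator_of_notMem hy]
        · rw [Metric.mem_closedBall, dist_eq_norm, not_le] at hy
          rw [norm_smul, norm_inv, Real.norm_of_nonneg hr0.le, lt_inv_mul_iff₀ hr0]
          linarith [hz.2]
  have hswap := integral_integral_swap hprod
  have hui : ∀ r : ℝ, 0 < r → Integrable fun y => u y * (r ^ (-(N : ℝ)) * e (r⁻¹ • (y - x))) := by
    intro r hr
    have h1 : Continuous fun y => r ^ (-(N : ℝ)) * e (r⁻¹ • (y - x)) :=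
      continuous_const.mul (he.continuous.comp (by fun_prop))
    have h2 : HasCompactSupport fun y => r ^ (-(N : ℝ)) * e (r⁻¹ • (y - x)) :=
      (hasCompactSupport_comp_dilation hs x hr).mul_left
    refine (h.locallyIntegrable.integrable_smul_left_of_hasCompactSupport h1 h2).congr
      (Filter.Eventually.of_forall fun y => ?_)
    simp [mul_comm]
  rw [← integral_sub (hui R (hε.trans_le hR)) (hui ε hε)]
  simp_rw [← hint]
  rw [← hswap]
  refine setIntegral_congr_fun measurableSet_Ioc fun r hr => ?_
  have hr0 : 0 < r := hε.trans hr.1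
  have := h.integral_radial he hs x hr0
  simp only [hk]
  calc _ = ∫ y, -(r ^ (-(N : ℝ) - 1)) * (u y * H (r⁻¹ • (y - x))) := by
        congr 1 with y; ring
    _ = _ := by
        rw [integral_const_mul, this]; ring

/-- On the support of the kernel `|⟨G, y - x⟩| ≤ r |G|`, and `r^(-N - 1) r = r^(1 - N - 1)` is the
scale weight of the potential of order `1`. The bound is uniform in `ε` and `R`. -/
lemma enorm_integral_dilation_sub_le {N : ℕ} {u : EuclideanSpace ℝ (Fin N) → ℝ}
    {G : EuclideanSpace ℝ (Fin N) → EuclideanSpace ℝ (Fin N)} (h : IsWeakGradient u G)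
    {e : EuclideanSpace ℝ (Fin N) → ℝ} (he : ContDiff ℝ ∞ e) (hs : ∀ z, 1 ≤ ‖z‖ → e z = 0)
    {B : ℝ≥0} (hB : ∀ z, ‖e z‖ₑ ≤ B)
    (x : EuclideanSpace ℝ (Fin N)) {ε R : ℝ} (hε : 0 < ε) (hR : ε ≤ R) :
    ‖(∫ y, u y * (R ^ (-(N : ℝ)) * e (R⁻¹ • (y - x)))) -
        ∫ y, u y * (ε ^ (-(N : ℝ)) * e (ε⁻¹ • (y - x)))‖ₑ ≤
      B * scalePotential 1 (fun y => ‖G y‖ₑ) x := by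
  rw [integral_dilation_sub_eq h he hs x hε hR]
  refine (enorm_integral_le_lintegral_enorm _).trans ?_
  rw [scalePotential, ← lintegral_const_mul' _ _ ENNReal.coe_ne_top]
  refine le_trans ?_ (lintegral_mono_set (s := Set.Ioc ε R) (Set.Ioc_subset_Ioi_self.trans (Set.Ioi_subset_Ioi hε.le)))
  refine setLIntegral_mono' measurableSet_Ioc fun r hr => ?_
  have hr0 : 0 < r := hε.trans hr.1
  have h1 : ‖∫ y, e (r⁻¹ • (y - x)) * inner ℝ (G y) (y - x)‖ₑ ≤
      B * ENNReal.ofReal r * ∫⁻ y in Metric.ball x r, ‖G y‖ₑ := by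
    refine (enorm_integral_le_lintegral_enorm _).trans ?_
    rw [← lintegral_indicator Metric.isOpen_ball.measurableSet,
      ← lintegral_const_mul' _ _ (ENNReal.mul_ne_top ENNReal.coe_ne_top ENNReal.ofReal_ne_top)]
    refine lintegral_mono fun y => ?_
    by_cases hy : y ∈ Metric.ball x r
    · rw [Set.indicator_of_mem hy, enorm_mul, mul_assoc]
      gcongr
      · exact hB _
      · rw [← ofReal_norm, ← ofReal_norm, ← ENNReal.ofReal_mul hr0.le]
        refine ENNReal.ofReal_le_ofReal ((norm_inner_le_norm _ _).trans ?_)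
        rw [mul_comm]
        gcongr
        rw [Metric.mem_ball, dist_eq_norm] at hy
        exact hy.le
    · rw [hs]
      · simp
      · rw [Metric.mem_ball, dist_eq_norm, not_lt] at hy
        rw [norm_smul, norm_inv, Real.norm_of_nonneg hr0.le, le_inv_mul_iff₀ hr0]
        linarith
  rw [enorm_mul]
  calc _ ≤ ‖r ^ (-(N : ℝ) - 1)‖ₑ * (B * ENNReal.ofReal r * ∫⁻ y in Metric.ball x r, ‖G y‖ₑ) :=
        mul_le_mul' le_rfl h1
    _ = B * ((ENNReal.ofReal (r ^ (-(N : ℝ) - 1)) * ENNReal.ofReal r) *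
        ∫⁻ y in Metric.ball x r, ‖G y‖ₑ) := by
        rw [Real.enorm_of_nonneg (by positivity)]; ring
    _ = _ := by
        rw [← ENNReal.ofReal_mul (by positivity), ← Real.rpow_add_one hr0.ne']
        congr 4
        ring

/-- Convergence holds at Lebesgue points: the kernel has total mass `1`, lives in the closed ball of
radius `r`, and is at most a constant over the volume of that ball. -/
lemma ae_tendsto_integral_dilation {N : ℕ} {u : EuclideanSpace ℝ (Fin N) → ℝ}
    (hu : LocallyIntegrable u volume)
    {e : EuclideanSpace ℝ (Fin N) → ℝ} (hs : ∀ z, 1 ≤ ‖z‖ → e z = 0)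
    {B : ℝ} (hB : ∀ z, |e z| ≤ B) (hI : ∫ z, e z = 1) :
    ∀ᵐ x, Filter.Tendsto (fun r : ℝ => ∫ y, u y * (r ^ (-(N : ℝ)) * e (r⁻¹ • (y - x))))
      (nhdsWithin 0 (Set.Ioi 0)) (nhds (u x)) := by
  filter_upwards [(Besicovitch.vitaliFamily volume).ae_tendsto_average_norm_sub hu] with x hx
  have h0 := hx.comp (Besicovitch.tendsto_filterAt volume x)
  have hV : 0 < volume.real (Metric.ball (0 : EuclideanSpace ℝ (Fin N)) 1) :=
    ENNReal.toReal_pos (Metric.measure_ball_pos _ _ one_pos).ne' measure_ball_lt_top.ne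
  have key := tendsto_integral_smul_of_tendsto_average_norm_sub
    (g := fun (r : ℝ) y => r ^ (-(N : ℝ)) * e (r⁻¹ • (y - x)))
    (B * volume.real (Metric.ball (0 : EuclideanSpace ℝ (Fin N)) 1)) h0
    (Filter.Eventually.of_forall fun r => hu.integrableOn_isCompact (isCompact_closedBall _ _))
    (by
      refine tendsto_const_nhds.congr' ?_
      filter_upwards [self_mem_nhdsWithin] with r (hr : 0 < r)
      rw [integral_const_mul, integral_sub_right_eq_self (fun y => e (r⁻¹ • y)) x,
        Measure.integral_comp_inv_smul_of_nonneg _ _ hr.le, finrank_euclideanSpace_fin, hI,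
        ← Real.rpow_natCast, smul_eq_mul, mul_one, ← Real.rpow_add hr]
      simp)
    (by
      filter_upwards [self_mem_nhdsWithin] with r (hr : 0 < r)
      intro y hy
      by_contra hcon
      apply hy
      rw [Metric.mem_closedBall, dist_eq_norm, not_le] at hcon
      simp only
      rw [hs, mul_zero]
      rw [norm_smul, norm_inv, Real.norm_of_nonneg hr.le, le_inv_mul_iff₀ hr]
      linarith)
    (by
      filter_upwards [self_mem_nhdsWithin] with r (hr : 0 < r)
      intro y
      rw [Measure.addHaar_real_closedBall _ _ hr.le, finrank_euclideanSpace_fin,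
        mul_div_mul_right _ _ hV.ne', abs_mul, abs_of_nonneg (by positivity),
        Real.rpow_neg hr.le, Real.rpow_natCast, div_eq_inv_mul]
      gcongr
      exact hB _)
  simpa only [smul_eq_mul, mul_comm] using key

/-- For `r ≥ ‖x‖` the kernel lives in `B(0, 2r)`, where Hölder's inequality bounds the mass of `u`
by a multiple of `r^(N - α - a)`. The mollification is therefore `O(r^(-(α + a)))`. This is where
the Morrey hypothesis on `u` serves; it excludes nonzero constants. -/
lemma tendsto_integral_dilation_atTop {N : ℕ} {γ α β p q lam : ℝ} (hγ : 0 < γ)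
    (hadm : HardySobolevAdmissible N γ α β p q lam) {u : EuclideanSpace ℝ (Fin N) → ℝ}
    (hu : MemMorrey p lam fun x => ‖x‖ ^ α * u x)
    {e : EuclideanSpace ℝ (Fin N) → ℝ} (hs : ∀ z, 1 ≤ ‖z‖ → e z = 0)
    {B : ℝ≥0} (hB : ∀ z, ‖e z‖ₑ ≤ B) (x : EuclideanSpace ℝ (Fin N)) :
    Filter.Tendsto (fun r : ℝ => ∫ y, u y * (r ^ (-(N : ℝ)) * e (r⁻¹ • (y - x))))
      Filter.atTop (nhds 0) := by
  obtain ⟨hN, hq, hlN, ha, hθ, hpq⟩ := hadm.exponents hγ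
  have hp0 : 0 < p := by linarith [hadm.one_lt_p]
  set a := (N - lam) / p with had
  -- From `β < (N - lam) / q = a - δ` one gets `α + a > γ > 0`.
  have haα : 0 < α + a := by
    have h1 := hadm.beta_lt
    have h2 := hadm.sum_nonneg
    have h3 := hadm.sum_le
    linarith
  set K := morreyNorm p lam fun x => ‖x‖ ^ α * u x with hK
  have hKt : K ≠ ⊤ := hu.2.ne
  have hb := morreyBound_morreyNorm (lam := lam) hp0 fun x => ‖x‖ ^ α * u x
  rw [← hK] at hb
  have hgm := hu.1.enorm
  set g := hgm.mk with hg
  have hgb : MorreyBound p lam K g := hb.congr hgm.ae_eq_mk.symm.le hp0.le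
  obtain ⟨D, hD⟩ := MorreyBound.lintegral_ball_zero_le hN (lam := lam) hadm.one_lt_p hadm.alpha_lt
  have : Nonempty (Fin N) := ⟨⟨0, hN⟩⟩
  have hne : ∀ᵐ x : EuclideanSpace ℝ (Fin N), x ≠ 0 := by simp [ae_iff]
  have hug : (fun y => ‖u y‖ₑ) =ᵐ[volume] fun y => ENNReal.ofReal (‖y‖ ^ (-α)) * g y := by
    filter_upwards [hne, hgm.ae_eq_mk] with y hy hy2
    rw [hg, ← hy2, enorm_mul, Real.enorm_of_nonneg (show (0 : ℝ) ≤ ‖y‖ ^ α by positivity), ← mul_assoc,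
      mul_comm (ENNReal.ofReal _) (ENNReal.ofReal _),
      ofReal_mul_ofReal_rpow_neg (norm_pos_iff.2 hy), one_mul]
  rw [tendsto_zero_iff_enorm_tendsto_zero]
  have hlim : Filter.Tendsto (fun r : ℝ => (B * D * K * ENNReal.ofReal (2 ^ (N - α - a))) *
      ENNReal.ofReal (r ^ (-(α + a)))) Filter.atTop (nhds 0) := by
    have h1 := ENNReal.tendsto_ofReal (tendsto_rpow_neg_atTop haα)
    have h2 := ENNReal.Tendsto.const_mul (a := B * D * K * ENNReal.ofReal (2 ^ (N - α - a))) h1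
      (Or.inr (by finiteness))
    simpa using h2
  refine tendsto_of_tendsto_of_tendsto_of_le_of_le' tendsto_const_nhds hlim
    (Filter.Eventually.of_forall fun _ => zero_le) ?_
  filter_upwards [Filter.eventually_gt_atTop 0, Filter.eventually_ge_atTop ‖x‖] with r hr hrx
  refine (enorm_integral_le_lintegral_enorm _).trans ?_
  calc _ ≤ ∫⁻ y in Metric.ball 0 (2 * r), ENNReal.ofReal (r ^ (-(N : ℝ))) * B * ‖u y‖ₑ := by
        rw [← lintegral_indicator Metric.isOpen_ball.measurableSet]
        refine lintegral_mono fun y => ?_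
        by_cases hy : y ∈ Metric.ball (0 : EuclideanSpace ℝ (Fin N)) (2 * r)
        · rw [Set.indicator_of_mem hy, enorm_mul, enorm_mul, mul_comm,
            Real.enorm_of_nonneg (by positivity)]
          gcongr
          exact hB _
        · rw [hs]
          · simp
          · rw [mem_ball_zero_iff, not_lt] at hy
            rw [norm_smul, norm_inv, Real.norm_of_nonneg hr.le, le_inv_mul_iff₀ hr]
            have := norm_sub_norm_le y x
            linarith
    _ = ENNReal.ofReal (r ^ (-(N : ℝ))) * B * ∫⁻ y in Metric.ball 0 (2 * r),
          ENNReal.ofReal (‖y‖ ^ (-α)) * g y := by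
        rw [lintegral_const_mul' _ _ (by finiteness), lintegral_congr_ae (ae_restrict_of_ae hug)]
    _ ≤ ENNReal.ofReal (r ^ (-(N : ℝ))) * B *
          (D * ENNReal.ofReal ((2 * r) ^ (N - α - a)) * K) := by
        gcongr
        exact hD K g hgm.measurable_mk hgb _ (by positivity)
    _ = (B * D * K * ENNReal.ofReal (2 ^ (N - α - a))) *
          (ENNReal.ofReal (r ^ (-(N : ℝ))) * ENNReal.ofReal (r ^ (N - α - a))) := by
        rw [Real.mul_rpow (by norm_num) hr.le, ENNReal.ofReal_mul (by positivity)]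
        ring
    _ = _ := by
        rw [← ENNReal.ofReal_mul (by positivity), ← Real.rpow_add hr]
        congr 3
        ring

/-- Pointwise control of a weakly differentiable function by the potential of its gradient. -/
theorem IsWeakGradient.enorm_le_scalePotential {N : ℕ} :
    ∃ B : ℝ≥0, ∀ {γ α β p q lam : ℝ}, 0 < γ → HardySobolevAdmissible N γ α β p q lam →
      ∀ {u : EuclideanSpace ℝ (Fin N) → ℝ}
        {G : EuclideanSpace ℝ (Fin N) → EuclideanSpace ℝ (Fin N)}, IsWeakGradient u G →
        MemMorrey p lam (fun x => ‖x‖ ^ α * u x) →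
        ∀ᵐ x, ‖u x‖ₑ ≤ B * scalePotential 1 (fun y => ‖G y‖ₑ) x := by
  let η : ContDiffBump (0 : EuclideanSpace ℝ (Fin N)) := ⟨1 / 2, 1, by norm_num, by norm_num⟩
  set e := η.normed volume with he
  have hec : ContDiff ℝ ∞ e := η.contDiff_normed
  have hs : ∀ z, 1 ≤ ‖z‖ → e z = 0 := by
    intro z hz
    have : η z = 0 := η.zero_of_le_dist (by simpa using hz)
    simp [he, ContDiffBump.normed_def, this]
  obtain ⟨B, hB⟩ := hec.continuous.bounded_above_of_compact_support η.hasCompactSupport_normed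
  refine ⟨B.toNNReal, fun {γ α β p q lam} hγ hadm {u G} h hu => ?_⟩
  have hBe : ∀ z, ‖e z‖ₑ ≤ (B.toNNReal : ℝ≥0∞) := by
    intro z
    rw [← ofReal_norm]
    exact ENNReal.ofReal_le_ofReal (hB z)
  filter_upwards [ae_tendsto_integral_dilation h.locallyIntegrable hs hB η.integral_normed] with x hx
  have h1 := tendsto_integral_dilation_atTop hγ hadm hu hs hBe x
  -- A single parameter drives both limits: the inner scale is `ε = R⁻¹`.
  have h2 := (h1.sub (hx.comp tendsto_inv_atTop_nhdsGT_zero)).enorm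
  rw [zero_sub, enorm_neg] at h2
  refine le_of_tendsto h2 ?_
  filter_upwards [Filter.eventually_ge_atTop 1] with R hR
  exact enorm_integral_dilation_sub_le h hec hs hBe x (by positivity)
    ((inv_le_one_of_one_le₀ hR).trans hR)

/-! ### From a pointwise potential bound to the norm inequality -/

/-- The step shared by the integer and fractional cases. The potential estimate asks for a finite
nonzero `K`, so it is applied with any such `L` above the norm; a vanishing norm is reached by
letting `L → 0`. -/
theorem hardySobolev_of_le_scalePotential {N : ℕ} {γ α β p q lam : ℝ} (hγ : 0 < γ)
    (h : HardySobolevAdmissible N γ α β p q lam) (c : ℝ≥0) :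
    ∃ C : ℝ≥0, 0 < C ∧ ∀ {F F' F'' : Type} [NormedAddCommGroup F] [NormedAddCommGroup F']
      [NormedAddCommGroup F''] (u : EuclideanSpace ℝ (Fin N) → F)
      (f : EuclideanSpace ℝ (Fin N) → F') (v : EuclideanSpace ℝ (Fin N) → ℝ)
      (w : EuclideanSpace ℝ (Fin N) → F''),
      AEStronglyMeasurable f volume →
      (∀ᵐ x, ‖u x‖ₑ ≤ c * scalePotential γ (fun y => ‖f y‖ₑ) x) →
      (∀ x, ‖v x‖ₑ = ENNReal.ofReal (‖x‖ ^ (-β)) * ‖u x‖ₑ) →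
      (∀ x, ‖w x‖ₑ = ENNReal.ofReal (‖x‖ ^ α) * ‖f x‖ₑ) →
      morreyNorm q lam v ≤ C * morreyNorm p lam w := by
  obtain ⟨hN, hq, hlN, ha, hθ, hpq⟩ := h.exponents hγ
  have hp0 : 0 < p := by linarith [h.one_lt_p]
  obtain ⟨A, hA⟩ := scalePotential_morreyBound hγ h
  -- The summand `1` makes the constant positive, so that its product with an infinite norm is
  -- infinite.
  refine ⟨c * A + 1, by positivity, fun {F F' F''} _ _ _ u f v w hf hu hv hw => ?_⟩
  set K := morreyNorm p lam w with hK
  have hb := morreyBound_morreyNorm (lam := lam) hp0 w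
  rw [← hK] at hb
  have key : ∀ L : ℝ≥0∞, K ≤ L → L ≠ 0 → L ≠ ⊤ → morreyNorm q lam v ≤ (c * A : ℝ≥0) * L := by
    intro L hKL hL0 hL
    have hfm := hf.enorm
    have h1 : MorreyBound p lam L (fun x => ENNReal.ofReal (‖x‖ ^ α) * hfm.mk _ x) := by
      refine (hb.mono hp0.le hKL).congr ?_ hp0.le
      filter_upwards [hfm.ae_eq_mk] with x hx
      rw [← hx, hw]
    have h2 := hA L _ hfm.measurable_mk hL0 hL h1
    rw [scalePotential_congr γ hfm.ae_eq_mk.symm] at h2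
    refine MorreyBound.morreyNorm_le hq fun x r hr => ?_
    calc ∫⁻ y in Metric.ball x r, ‖v y‖ₑ ^ q ≤ ∫⁻ y in Metric.ball x r, (c : ℝ≥0∞) ^ q *
          (ENNReal.ofReal (‖y‖ ^ (-β)) * scalePotential γ (fun y => ‖f y‖ₑ) y) ^ q := by
          refine lintegral_mono_ae (ae_restrict_of_ae ?_)
          filter_upwards [hu] with y hy
          rw [← ENNReal.mul_rpow_of_nonneg _ _ hq.le, hv]
          refine ENNReal.rpow_le_rpow ?_ hq.le
          calc _ ≤ ENNReal.ofReal (‖y‖ ^ (-β)) * (c * scalePotential γ (fun y => ‖f y‖ₑ) y) :=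
                mul_le_mul' le_rfl hy
            _ = _ := by ring
      _ = (c : ℝ≥0∞) ^ q * ∫⁻ y in Metric.ball x r,
          (ENNReal.ofReal (‖y‖ ^ (-β)) * scalePotential γ (fun y => ‖f y‖ₑ) y) ^ q :=
          lintegral_const_mul' _ _ (ENNReal.rpow_ne_top_of_nonneg hq.le ENNReal.coe_ne_top)
      _ ≤ (c : ℝ≥0∞) ^ q * (ENNReal.ofReal (r ^ lam) * (A * L) ^ q) := mul_le_mul' le_rfl (h2 x r hr)
      _ = _ := by
          push_cast
          rw [mul_assoc (c : ℝ≥0∞), ENNReal.mul_rpow_of_nonneg (c : ℝ≥0∞) _ hq.le]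
          ring
  rcases eq_or_ne K ⊤ with hKt | hKt
  · rw [hKt, ENNReal.mul_top (by simp)]
    exact le_top
  rcases eq_or_ne K 0 with hK0 | hK0
  · rw [hK0, mul_zero]
    have hlim : Filter.Tendsto (fun L : ℝ≥0∞ => ((c * A : ℝ≥0) : ℝ≥0∞) * L) (nhdsWithin 0 (Set.Ioi 0))
        (nhds 0) := by
      have := (ENNReal.Tendsto.const_mul (a := ((c * A : ℝ≥0) : ℝ≥0∞)) (b := 0) Filter.tendsto_id
        (Or.inr ENNReal.coe_ne_top))
      rw [mul_zero] at this
      exact this.mono_left nhdsWithin_le_nhds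
    refine ge_of_tendsto hlim ?_
    filter_upwards [self_mem_nhdsWithin, nhdsWithin_le_nhds (Iio_mem_nhds ENNReal.zero_lt_top)]
      with L (hL : 0 < L) (hL2 : L < ⊤)
    exact key L (by rw [hK0]; exact hL.le) hL.ne' hL2.ne
  · refine (key K le_rfl hK0 hKt).trans ?_
    gcongr
    exact le_self_add

/-! ### The Fourier symbol of the fractional Laplacian -/

lemma norm_character {N : ℕ} (ξ x : EuclideanSpace ℝ (Fin N)) :
    ‖Complex.exp (((2 * Real.pi * inner ℝ ξ x : ℝ) : ℂ) * Complex.I)‖ = 1 :=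
  Complex.norm_exp_ofReal_mul_I _

/-- Near the origin the numerator is `O(|y|^2)`, which suffices since `s < 1`; away from it the
numerator is at most `2`, which suffices since `s > 0`. -/
lemma integrable_one_sub_cos_div_norm_rpow {N : ℕ} (hN : 0 < N) {s : ℝ} (hs0 : 0 < s) (hs1 : s < 1)
    (ξ : EuclideanSpace ℝ (Fin N)) :
    Integrable fun y : EuclideanSpace ℝ (Fin N) =>
      (1 - Real.cos (2 * Real.pi * inner ℝ ξ y)) / ‖y‖ ^ ((N : ℝ) + 2 * s) := by
  have hmeas : AEStronglyMeasurable (fun y : EuclideanSpace ℝ (Fin N) =>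
      (1 - Real.cos (2 * Real.pi * inner ℝ ξ y)) / ‖y‖ ^ ((N : ℝ) + 2 * s)) volume := by
    refine Measurable.aestronglyMeasurable (Measurable.div ?_ (measurable_norm.pow_const _))
    exact (by fun_prop : Continuous fun y : EuclideanSpace ℝ (Fin N) =>
      1 - Real.cos (2 * Real.pi * inner ℝ ξ y)).measurable
  rw [← integrableOn_univ, ← Set.union_compl_self (Metric.ball (0 : EuclideanSpace ℝ (Fin N)) 1)]
  refine IntegrableOn.union ?_ ?_
  · have : Nonempty (Fin N) := ⟨⟨0, hN⟩⟩
    have hne : ∀ᵐ x : EuclideanSpace ℝ (Fin N), x ≠ 0 := by simp [ae_iff]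
    refine integrableOn_ball_of_norm_le_rpow (C := (2 * Real.pi * ‖ξ‖) ^ 2 / 2)
      (α := (N : ℝ) + 2 * s - 2) (by rw [finrank_euclideanSpace_fin]; exact hN)
      (by rw [finrank_euclideanSpace_fin]; linarith) (ae_restrict_of_ae ?_) hmeas
    filter_upwards [hne] with y hy
    have hy0 : 0 < ‖y‖ := norm_pos_iff.2 hy
    rw [Real.norm_of_nonneg (div_nonneg (by linarith [Real.cos_le_one (2 * Real.pi * inner ℝ ξ y)])
      (by positivity)), div_le_iff₀ (by positivity),
      mul_assoc ((2 * Real.pi * ‖ξ‖) ^ 2 / 2), ← Real.rpow_add hy0,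
      show -((N : ℝ) + 2 * s - 2) + (N + 2 * s) = (2 : ℕ) by push_cast; ring, Real.rpow_natCast]
    have h1 := Real.one_sub_sq_div_two_le_cos (x := 2 * Real.pi * inner ℝ ξ y)
    have h2 : (2 * Real.pi * inner ℝ ξ y) ^ 2 ≤ (2 * Real.pi * (‖ξ‖ * ‖y‖)) ^ 2 := by
      rw [mul_pow, mul_pow (2 * Real.pi)]
      gcongr ?_ * ?_
      rw [← sq_abs]
      exact pow_le_pow_left₀ (abs_nonneg _) (abs_real_inner_le_norm ξ y) 2
    nlinarith [h1, h2]
  · have hJ : Integrable fun y : EuclideanSpace ℝ (Fin N) =>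
        (2 * 2 ^ ((N : ℝ) + 2 * s)) * (1 + ‖y‖) ^ (-((N : ℝ) + 2 * s)) := by
      refine (integrable_one_add_norm ?_).const_mul _
      rw [finrank_euclideanSpace_fin]; linarith
    refine hJ.integrableOn.mono' hmeas.restrict ?_
    filter_upwards [ae_restrict_mem Metric.isOpen_ball.measurableSet.compl] with y hy
    have hy1 : 1 ≤ ‖y‖ := by simpa using hy
    have hc := Real.cos_le_one (2 * Real.pi * inner ℝ ξ y)
    have hc' := Real.neg_one_le_cos (2 * Real.pi * inner ℝ ξ y)
    rw [Real.norm_of_nonneg (div_nonneg (by linarith) (by positivity))]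
    have h3 : 2 ^ ((N : ℝ) + 2 * s) / (1 + ‖y‖) ^ ((N : ℝ) + 2 * s) ≥ 1 / ‖y‖ ^ ((N : ℝ) + 2 * s) := by
      rw [ge_iff_le, div_le_div_iff₀ (by positivity) (by positivity), one_mul,
        ← Real.mul_rpow (by norm_num) (norm_nonneg _)]
      exact Real.rpow_le_rpow (by positivity) (by linarith) (by positivity)
    calc _ ≤ 2 / ‖y‖ ^ ((N : ℝ) + 2 * s) := by gcongr; linarith
      _ = 2 * (1 / ‖y‖ ^ ((N : ℝ) + 2 * s)) := by ring
      _ ≤ 2 * (2 ^ ((N : ℝ) + 2 * s) / (1 + ‖y‖) ^ ((N : ℝ) + 2 * s)) := by gcongr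
      _ = _ := by rw [Real.rpow_neg (by positivity)]; ring

/-- The Fourier symbol of the second-difference operator is a multiple of `‖ξ‖ ^ (2 * s)`. -/
lemma integral_one_sub_cos_div_norm_rpow {N : ℕ} (hN : 0 < N) {s : ℝ} (hs0 : 0 < s) (hs1 : s < 1) :
    ∃ c : ℝ, 0 < c ∧ ∀ ξ : EuclideanSpace ℝ (Fin N),
      ∫ y : EuclideanSpace ℝ (Fin N),
        (1 - Real.cos (2 * Real.pi * inner ℝ ξ y)) / ‖y‖ ^ ((N : ℝ) + 2 * s) = c * ‖ξ‖ ^ (2 * s) := by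
  set m : EuclideanSpace ℝ (Fin N) → ℝ := fun ξ => ∫ y : EuclideanSpace ℝ (Fin N),
    (1 - Real.cos (2 * Real.pi * inner ℝ ξ y)) / ‖y‖ ^ ((N : ℝ) + 2 * s) with hm
  set e₀ : EuclideanSpace ℝ (Fin N) := EuclideanSpace.single ⟨0, hN⟩ 1 with he₀
  have hne₀ : ‖e₀‖ = 1 := by simp [he₀]
  refine ⟨m e₀, ?_, fun ξ => ?_⟩
  · rw [hm, integral_pos_iff_support_of_nonneg (fun y => div_nonneg
      (by linarith [Real.cos_le_one (2 * Real.pi * inner ℝ e₀ y)]) (by positivity))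
      (integrable_one_sub_cos_div_norm_rpow hN hs0 hs1 e₀)]
    have hopen : IsOpen {y : EuclideanSpace ℝ (Fin N) | Real.cos (2 * Real.pi * inner ℝ e₀ y) < 1} :=
      isOpen_lt (by fun_prop) continuous_const
    refine lt_of_lt_of_le (hopen.measure_pos volume ⟨(1 / 2 : ℝ) • e₀, ?_⟩) (measure_mono fun y hy => ?_)
    · change Real.cos _ < 1
      rw [inner_smul_right, real_inner_self_eq_norm_sq, hne₀,
        show 2 * Real.pi * (1 / 2 * 1 ^ 2) = Real.pi by ring, Real.cos_pi]
      norm_num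
    · have hy : Real.cos (2 * Real.pi * inner ℝ e₀ y) < 1 := hy
      have hy0 : y ≠ 0 := by
        rintro rfl
        simp at hy
      have : 0 < ‖y‖ := norm_pos_iff.2 hy0
      exact (div_pos (by linarith) (by positivity)).ne'
  · rcases eq_or_ne ξ 0 with rfl | hξ
    · simp [Real.zero_rpow (by positivity : 2 * s ≠ 0)]
    set R := ‖ξ‖ with hR
    have hR0 : 0 < R := norm_pos_iff.2 hξ
    set v := R⁻¹ • ξ with hv
    have hv1 : ‖v‖ = 1 := by
      rw [hv, norm_smul, norm_inv, Real.norm_of_nonneg hR0.le, ← hR, inv_mul_cancel₀ hR0.ne']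
    -- The reflection exchanging `e₀` and `v` shows that the integral is the same for all unit
    -- vectors; dilation by `‖ξ‖` then gives its homogeneity of degree `2 * s`.
    set ρ := (Submodule.span ℝ {e₀ - v})ᗮ.reflection with hρ
    have hρe : ρ e₀ = v := Submodule.reflection_sub (by rw [hne₀, hv1])
    have hρv : ρ v = e₀ := by rw [← hρe]; exact Submodule.reflection_reflection _ _
    have hinner : ∀ y, inner ℝ v (ρ y) = inner ℝ e₀ y := by
      intro y
      rw [← hρe]
      exact ρ.inner_map_map e₀ y
    have h1 : m v = m e₀ := by
      have := MeasureTheory.integral_comp ρ (fun y : EuclideanSpace ℝ (Fin N) =>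
        (1 - Real.cos (2 * Real.pi * inner ℝ v y)) / ‖y‖ ^ ((N : ℝ) + 2 * s))
      simp only [hinner, LinearIsometryEquiv.norm_map] at this
      exact this.symm
    have h2 := Measure.integral_comp_smul_of_nonneg volume (fun y : EuclideanSpace ℝ (Fin N) =>
        (1 - Real.cos (2 * Real.pi * inner ℝ v y)) / ‖y‖ ^ ((N : ℝ) + 2 * s)) R (hR := hR0.le)
    have h3 : ∀ y : EuclideanSpace ℝ (Fin N),
        (1 - Real.cos (2 * Real.pi * inner ℝ v (R • y))) / ‖R • y‖ ^ ((N : ℝ) + 2 * s) =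
        (R ^ ((N : ℝ) + 2 * s))⁻¹ *
          ((1 - Real.cos (2 * Real.pi * inner ℝ ξ y)) / ‖y‖ ^ ((N : ℝ) + 2 * s)) := by
      intro y
      rw [inner_smul_right, hv, inner_smul_left, norm_smul, Real.norm_of_nonneg hR0.le,
        Real.mul_rpow hR0.le (norm_nonneg _)]
      have : R * ((starRingEnd ℝ) R⁻¹ * inner ℝ ξ y) = inner ℝ ξ y := by
        simp only [conj_trivial]
        field_simp
      rw [this, div_eq_mul_inv, div_eq_mul_inv, mul_inv]
      ring
    simp_rw [h3] at h2
    rw [integral_const_mul, finrank_euclideanSpace_fin] at h2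
    have h4 : m ξ = R ^ ((N : ℝ) + 2 * s) * ((R ^ N)⁻¹ * m v) := by
      rw [hm]
      simp only [smul_eq_mul] at h2
      rw [← h2, ← mul_assoc, mul_inv_cancel₀ (by positivity), one_mul]
    change m ξ = _
    rw [h4, h1, Real.rpow_add hR0, Real.rpow_natCast]
    field_simp

lemma SchwartzMap.ofReal_eq_integral_character {N : ℕ} (u : SchwartzMap (EuclideanSpace ℝ (Fin N)) ℝ) :
    ∃ W : SchwartzMap (EuclideanSpace ℝ (Fin N)) ℂ, ∀ x, (u x : ℂ) =
      ∫ ξ, Complex.exp (((2 * Real.pi * inner ℝ ξ x : ℝ) : ℂ) * Complex.I) * W ξ := by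
  set U : SchwartzMap (EuclideanSpace ℝ (Fin N)) ℂ := SchwartzMap.postcompCLM Complex.ofRealCLM u with hU
  refine ⟨FourierTransform.fourier U, fun x => ?_⟩
  have h1 : FourierTransformInv.fourierInv (FourierTransform.fourier U) = U :=
    FourierTransform.fourierInv_fourier_eq U
  have h2 := congrArg (fun V : SchwartzMap (EuclideanSpace ℝ (Fin N)) ℂ => V x) h1
  simp only [SchwartzMap.fourierInv_coe, Real.fourierInv_eq', smul_eq_mul] at h2
  rw [h2, hU]
  rfl

lemma SchwartzMap.integrable_norm_rpow_mul {N : ℕ} (W : SchwartzMap (EuclideanSpace ℝ (Fin N)) ℂ)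
    {a : ℝ} (ha0 : 0 ≤ a) (ha2 : a ≤ 2) : Integrable fun ξ => ((‖ξ‖ ^ a : ℝ) : ℂ) * W ξ := by
  have h1 : Integrable fun ξ => ‖W ξ‖ + ‖ξ‖ ^ 2 * ‖W ξ‖ :=
    W.integrable.norm.add (W.integrable_pow_mul volume 2)
  refine h1.mono' ?_ (Filter.Eventually.of_forall fun ξ => ?_)
  · refine Measurable.aestronglyMeasurable (Measurable.mul ?_ W.continuous.measurable)
    exact Complex.measurable_ofReal.comp (measurable_norm.pow_const _)
  · rw [norm_mul, Complex.norm_real, Real.norm_of_nonneg (by positivity)]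
    have : ‖ξ‖ ^ a ≤ 1 + ‖ξ‖ ^ 2 := by
      rcases le_total ‖ξ‖ 1 with h | h
      · have := Real.rpow_le_one (norm_nonneg ξ) h ha0
        nlinarith [sq_nonneg ‖ξ‖]
      · have := Real.rpow_le_rpow_of_exponent_le h ha2
        rw [Real.rpow_two] at this
        linarith
    calc _ ≤ (1 + ‖ξ‖ ^ 2) * ‖W ξ‖ := by gcongr
      _ = _ := by ring

/-- Tonelli's criterion for a nonnegative kernel times a function of the first variable. It
justifies exchanging integrals both for the symbol of the fractional Laplacian and for the Gamma
integral. -/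
lemma integrable_uncurry_ofReal_mul {X Y : Type*} [MeasurableSpace X] [MeasurableSpace Y]
    {μ : Measure X} {ν : Measure Y} [SFinite μ] [SFinite ν] {k : X → Y → ℝ}
    (hk : Measurable (Function.uncurry k)) (hk0 : ∀ᵐ a ∂μ, 0 ≤ᵐ[ν] k a) {V : X → ℂ}
    (hV : AEStronglyMeasurable V μ) (h1 : ∀ᵐ a ∂μ, Integrable (k a) ν)
    (h2 : Integrable (fun a => (∫ b, k a b ∂ν) * ‖V a‖) μ) :
    Integrable (Function.uncurry fun a b => (k a b : ℂ) * V a) (μ.prod ν) := by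
  rw [integrable_prod_iff]
  · refine ⟨?_, ?_⟩
    · filter_upwards [h1] with a ha
      have h := (ha.ofReal (𝕜 := ℂ)).mul_const (V a)
      simpa [Function.uncurry] using h
    · refine h2.congr ?_
      filter_upwards [hk0] with a ha
      rw [← integral_mul_const]
      refine integral_congr_ae ?_
      filter_upwards [ha] with b hb
      rw [Function.uncurry, norm_mul, Complex.norm_real, Real.norm_of_nonneg hb]
  · exact (Complex.measurable_ofReal.comp hk).aestronglyMeasurable.mul hV.comp_fst

/-- The second difference acts on a character as multiplication by `2 (1 - cos)`, and the factor `2`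
absorbs the `1 / 2` in the definition. The value of `c` is never needed, only its sign later on. -/
lemma fracLaplacian_eq_integral_character {N : ℕ} {s c : ℝ} (hN : 0 < N) (hs0 : 0 < s) (hs1 : s < 1)
    (hc : ∀ ξ : EuclideanSpace ℝ (Fin N), ∫ y : EuclideanSpace ℝ (Fin N),
        (1 - Real.cos (2 * Real.pi * inner ℝ ξ y)) / ‖y‖ ^ ((N : ℝ) + 2 * s) = c * ‖ξ‖ ^ (2 * s))
    {u : SchwartzMap (EuclideanSpace ℝ (Fin N)) ℝ} {W : SchwartzMap (EuclideanSpace ℝ (Fin N)) ℂ}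
    (hW : ∀ x, (u x : ℂ) =
      ∫ ξ, Complex.exp (((2 * Real.pi * inner ℝ ξ x : ℝ) : ℂ) * Complex.I) * W ξ)
    (x : EuclideanSpace ℝ (Fin N)) :
    (fracLaplacian s u x : ℂ) = ∫ ξ, Complex.exp (((2 * Real.pi * inner ℝ ξ x : ℝ) : ℂ) * Complex.I) *
      (((fracLaplacianConst N s * c : ℝ) : ℂ) * (((‖ξ‖ ^ (2 * s) : ℝ) : ℂ) * W ξ)) := by
  set χ : EuclideanSpace ℝ (Fin N) → EuclideanSpace ℝ (Fin N) → ℂ := fun ξ x =>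
    Complex.exp (((2 * Real.pi * inner ℝ ξ x : ℝ) : ℂ) * Complex.I) with hχ
  have hχn : ∀ ξ x, ‖χ ξ x‖ = 1 := norm_character
  have hχc : ∀ x, Continuous fun ξ => χ ξ x := fun x => by fun_prop
  have hint : ∀ x, Integrable fun ξ => χ ξ x * W ξ := fun x =>
    W.integrable.bdd_mul (c := 1) (hχc x).aestronglyMeasurable
      (Filter.Eventually.of_forall fun ξ => (hχn ξ x).le)
  set k : EuclideanSpace ℝ (Fin N) → EuclideanSpace ℝ (Fin N) → ℝ := fun ξ y =>
    (1 - Real.cos (2 * Real.pi * inner ℝ ξ y)) / ‖y‖ ^ ((N : ℝ) + 2 * s) with hk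
  have hk0 : ∀ ξ y, 0 ≤ k ξ y := fun ξ y =>
    div_nonneg (by linarith [Real.cos_le_one (2 * Real.pi * inner ℝ ξ y)]) (by positivity)
  have hdiff : ∀ y, (((2 * u x - u (x + y) - u (x - y)) / ‖y‖ ^ ((N : ℝ) + 2 * s) : ℝ) : ℂ) =
      2 * ∫ ξ, (k ξ y : ℂ) * (χ ξ x * W ξ) := by
    intro y
    have e1 : ((2 * u x - u (x + y) - u (x - y) : ℝ) : ℂ) =
        ∫ ξ, (2 * (χ ξ x * W ξ) - χ ξ (x + y) * W ξ - χ ξ (x - y) * W ξ) := by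
      have hsub : Integrable fun ξ => 2 * (χ ξ x * W ξ) - χ ξ (x + y) * W ξ :=
        ((hint x).const_mul 2).sub (hint (x + y))
      rw [integral_sub hsub (hint (x - y)),
        integral_sub ((hint x).const_mul 2) (hint (x + y)), integral_const_mul]
      push_cast
      rw [hW x, hW (x + y), hW (x - y)]
    rw [Complex.ofReal_div, e1, ← integral_div, ← integral_const_mul]
    congr 1 with ξ
    have h1 : χ ξ (x + y) + χ ξ (x - y) =
        2 * (Real.cos (2 * Real.pi * inner ℝ ξ y) : ℂ) * χ ξ x := by
      simp only [hχ, inner_add_right, inner_sub_right]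
      push_cast
      rw [Complex.two_cos, add_mul, ← Complex.exp_add, ← Complex.exp_add]
      congr 2 <;> ring
    have h2 : 2 * (χ ξ x * W ξ) - χ ξ (x + y) * W ξ - χ ξ (x - y) * W ξ =
        (2 * χ ξ x - (χ ξ (x + y) + χ ξ (x - y))) * W ξ := by ring
    rw [h2, h1, hk]
    push_cast
    ring
  have hkm : Measurable (Function.uncurry k) := by
    refine Measurable.div ?_ ((measurable_norm.comp measurable_snd).pow_const _)
    exact (by fun_prop : Continuous fun z : EuclideanSpace ℝ (Fin N) × EuclideanSpace ℝ (Fin N) =>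
      1 - Real.cos (2 * Real.pi * inner ℝ z.1 z.2)).measurable
  have hprod := integrable_uncurry_ofReal_mul (μ := volume) (ν := volume) hkm
    (Filter.Eventually.of_forall fun ξ => Filter.Eventually.of_forall (hk0 ξ))
    (V := fun ξ => χ ξ x * W ξ) (hint x).aestronglyMeasurable
    (Filter.Eventually.of_forall fun ξ => integrable_one_sub_cos_div_norm_rpow hN hs0 hs1 ξ) (by
      refine ((W.integrable_norm_rpow_mul (a := 2 * s) (by linarith) (by linarith)).norm.const_mul
        c).congr (Filter.Eventually.of_forall fun ξ => ?_)
      simp only [norm_mul, hχn, one_mul, Complex.norm_real]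
      rw [hk, hc ξ, Real.norm_of_nonneg (by positivity)]
      ring)
  have hswap := integral_integral_swap hprod
  rw [fracLaplacian, Complex.ofReal_mul, ← integral_complex_ofReal]
  simp_rw [hdiff]
  rw [integral_const_mul, ← hswap, ← integral_const_mul, ← integral_const_mul]
  congr 1 with ξ
  have h1 : ∫ y, (k ξ y : ℂ) * (χ ξ x * W ξ) = ((c * ‖ξ‖ ^ (2 * s) : ℝ) : ℂ) * (χ ξ x * W ξ) := by
    rw [integral_mul_const, integral_complex_ofReal, hk, hc ξ]
  rw [h1]
  change _ = χ ξ x * _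
  push_cast
  ring

/-! ### Inverting the fractional Laplacian by Gaussian averages -/

lemma integrable_gaussian_euclidean {N : ℕ} {b : ℝ} (hb : 0 < b) (x : EuclideanSpace ℝ (Fin N)) :
    Integrable fun y : EuclideanSpace ℝ (Fin N) => Real.exp (-b * ‖y - x‖ ^ 2) := by
  have h := (GaussianFourier.integrable_cexp_neg_mul_sq_norm_add (b := (b : ℂ)) (by simpa using hb) 0
    (0 : EuclideanSpace ℝ (Fin N))).norm
  have h2 : Integrable fun y : EuclideanSpace ℝ (Fin N) => Real.exp (-b * ‖y‖ ^ 2) := by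
    refine h.congr (Filter.Eventually.of_forall fun y => ?_)
    simp only [Complex.norm_exp]
    congr 1
    simp [← Complex.ofReal_pow]
  exact h2.comp_sub_right x

/-- The kernel `t^(-N/2) exp(-π |y - x|^2 / t)` is the heat kernel at time `t / (4π)`; characters
are its eigenfunctions. -/
lemma integral_gaussian_mul_character {N : ℕ} {t : ℝ} (ht : 0 < t) (ξ x : EuclideanSpace ℝ (Fin N)) :
    ∫ y : EuclideanSpace ℝ (Fin N),
        ((t ^ (-((N : ℝ) / 2)) * Real.exp (-(Real.pi / t) * ‖y - x‖ ^ 2) : ℝ) : ℂ) *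
          Complex.exp (((2 * Real.pi * inner ℝ ξ y : ℝ) : ℂ) * Complex.I) =
      ((Real.exp (-(Real.pi * ‖ξ‖ ^ 2 * t)) : ℝ) : ℂ) *
        Complex.exp (((2 * Real.pi * inner ℝ ξ x : ℝ) : ℂ) * Complex.I) := by
  have hb : 0 < Real.pi / t := by positivity
  have h1 := GaussianFourier.integral_cexp_neg_mul_sq_norm_add (b := ((Real.pi / t : ℝ) : ℂ))
    (by rw [Complex.ofReal_re]; exact hb) (2 * Real.pi * Complex.I) ξ
  have h2 : ((Real.pi : ℂ) / ((Real.pi / t : ℝ) : ℂ)) = (t : ℂ) := by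
    push_cast
    have : (Real.pi : ℂ) ≠ 0 := by exact_mod_cast Real.pi_ne_zero
    have : (t : ℂ) ≠ 0 := by exact_mod_cast ht.ne'
    field_simp
  rw [h2, finrank_euclideanSpace_fin] at h1
  have h3 : (t : ℂ) ^ ((N : ℂ) / 2) = ((t ^ ((N : ℝ) / 2) : ℝ) : ℂ) := by
    rw [Complex.ofReal_cpow ht.le]; push_cast; rfl
  have h4 : (2 * Real.pi * Complex.I) ^ 2 * (‖ξ‖ : ℂ) ^ 2 / (4 * ((Real.pi / t : ℝ) : ℂ)) =
      ((-(Real.pi * ‖ξ‖ ^ 2 * t) : ℝ) : ℂ) := by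
    push_cast
    have : (Real.pi : ℂ) ≠ 0 := by exact_mod_cast Real.pi_ne_zero
    have : (t : ℂ) ≠ 0 := by exact_mod_cast ht.ne'
    rw [mul_pow, mul_pow, Complex.I_sq]
    field_simp
    ring
  rw [h3, h4] at h1
  rw [← integral_add_right_eq_self _ x]
  have h5 : ∀ v : EuclideanSpace ℝ (Fin N),
      ((t ^ (-((N : ℝ) / 2)) * Real.exp (-(Real.pi / t) * ‖v + x - x‖ ^ 2) : ℝ) : ℂ) *
          Complex.exp (((2 * Real.pi * inner ℝ ξ (v + x) : ℝ) : ℂ) * Complex.I) =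
      (((t ^ (-((N : ℝ) / 2)) : ℝ) : ℂ) *
        Complex.exp (((2 * Real.pi * inner ℝ ξ x : ℝ) : ℂ) * Complex.I)) *
      Complex.exp (-((Real.pi / t : ℝ) : ℂ) * (‖v‖ : ℂ) ^ 2 + 2 * Real.pi * Complex.I * (inner ℝ ξ v : ℝ)) := by
    intro v
    rw [add_sub_cancel_right, inner_add_right, Complex.ofReal_mul, Complex.ofReal_exp,
      mul_assoc (_ : ℂ) (Complex.exp _) (Complex.exp _), mul_assoc (_ : ℂ) (Complex.exp _) (Complex.exp _),
      ← Complex.exp_add, ← Complex.exp_add]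
    congr 2
    push_cast
    ring
  simp_rw [h5]
  rw [integral_const_mul, h1, ← Complex.ofReal_exp]
  have h6 : ((t ^ (-((N : ℝ) / 2)) : ℝ) : ℂ) * ((t ^ ((N : ℝ) / 2) : ℝ) : ℂ) = 1 := by
    rw [← Complex.ofReal_mul, ← Real.rpow_add ht]; simp
  linear_combination (Complex.exp (((2 * Real.pi * inner ℝ ξ x : ℝ) : ℂ) * Complex.I) *
    ((Real.exp (-(Real.pi * ‖ξ‖ ^ 2 * t)) : ℝ) : ℂ)) * h6

lemma integral_gaussian_mul_eq {N : ℕ} {f : EuclideanSpace ℝ (Fin N) → ℝ}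
    {V : EuclideanSpace ℝ (Fin N) → ℂ} (hV : Integrable V)
    (hf : ∀ y, (f y : ℂ) =
      ∫ ξ, Complex.exp (((2 * Real.pi * inner ℝ ξ y : ℝ) : ℂ) * Complex.I) * V ξ)
    {t : ℝ} (ht : 0 < t) (x : EuclideanSpace ℝ (Fin N)) :
    ((∫ y, t ^ (-((N : ℝ) / 2)) * Real.exp (-(Real.pi / t) * ‖y - x‖ ^ 2) * f y : ℝ) : ℂ) =
      ∫ ξ, ((Real.exp (-(Real.pi * ‖ξ‖ ^ 2 * t)) : ℝ) : ℂ) *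
        (Complex.exp (((2 * Real.pi * inner ℝ ξ x : ℝ) : ℂ) * Complex.I) * V ξ) := by
  set g : EuclideanSpace ℝ (Fin N) → ℝ := fun y =>
    t ^ (-((N : ℝ) / 2)) * Real.exp (-(Real.pi / t) * ‖y - x‖ ^ 2) with hg
  have hgi : Integrable g := (integrable_gaussian_euclidean (by positivity) x).const_mul _
  have hgc : Integrable fun y => (g y : ℂ) := hgi.ofReal
  have hprod : Integrable (Function.uncurry fun y ξ =>
      Complex.exp (((2 * Real.pi * inner ℝ ξ y : ℝ) : ℂ) * Complex.I) * ((g y : ℂ) * V ξ))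
      ((volume : Measure (EuclideanSpace ℝ (Fin N))).prod
        (volume : Measure (EuclideanSpace ℝ (Fin N)))) := by
    have h := hgc.mul_prod hV
    have hc : Continuous fun z : EuclideanSpace ℝ (Fin N) × EuclideanSpace ℝ (Fin N) =>
      Complex.exp (((2 * Real.pi * inner ℝ z.2 z.1 : ℝ) : ℂ) * Complex.I) := by fun_prop
    exact h.bdd_mul (c := 1) hc.aestronglyMeasurable
      (Filter.Eventually.of_forall fun z => (norm_character _ _).le)
  have hswap := integral_integral_swap hprod
  calc _ = ∫ y, ∫ ξ, Complex.exp (((2 * Real.pi * inner ℝ ξ y : ℝ) : ℂ) * Complex.I) *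
        ((g y : ℂ) * V ξ) := by
        rw [← integral_complex_ofReal]
        congr 1 with y
        rw [Complex.ofReal_mul, hf y, ← integral_const_mul]
        congr 1 with ξ
        ring
    _ = _ := by
        rw [hswap]
        congr 1 with ξ
        rw [← mul_assoc, ← integral_gaussian_mul_character ht ξ x, ← integral_mul_const]
        congr 1 with y
        ring

/-- For `ξ ≠ 0` the Gamma integral of `t^(s - 1) exp(-π |ξ|^2 t)` is `Γ(s) (π |ξ|^2)^(-s)`, which
cancels `|ξ|^(2s)`. The identity fails at `ξ = 0`, a null set. -/
lemma integral_rpow_mul_gaussian_symbol {N : ℕ} (hN : 0 < N) {s : ℝ} (hs : 0 < s)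
    {V : EuclideanSpace ℝ (Fin N) → ℂ} (hV : Integrable V) :
    ∫ t in Set.Ioi (0 : ℝ), ∫ ξ, ((t ^ (s - 1) * Real.exp (-(Real.pi * ‖ξ‖ ^ 2 * t)) *
        ‖ξ‖ ^ (2 * s) : ℝ) : ℂ) * V ξ =
      ((Real.Gamma s * Real.pi ^ (-s) : ℝ) : ℂ) * ∫ ξ, V ξ := by
  have : Nonempty (Fin N) := ⟨⟨0, hN⟩⟩
  have hne : ∀ᵐ x : EuclideanSpace ℝ (Fin N), x ≠ 0 := by simp [ae_iff]
  set k : EuclideanSpace ℝ (Fin N) → ℝ → ℝ := fun ξ t =>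
    t ^ (s - 1) * Real.exp (-(Real.pi * ‖ξ‖ ^ 2 * t)) * ‖ξ‖ ^ (2 * s) with hk
  have hkI : ∀ ξ : EuclideanSpace ℝ (Fin N), ξ ≠ 0 →
      ∫ t in Set.Ioi (0 : ℝ), k ξ t = Real.Gamma s * Real.pi ^ (-s) := by
    intro ξ hξ
    have hX : 0 < ‖ξ‖ := norm_pos_iff.2 hξ
    rw [hk, integral_mul_const, Real.integral_rpow_mul_exp_neg_mul_Ioi hs (by positivity), one_div,
      Real.inv_rpow (by positivity), Real.mul_rpow (by positivity) (by positivity),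
      ← Real.rpow_natCast, ← Real.rpow_mul hX.le, Real.rpow_neg (by positivity)]
    push_cast
    field_simp
  have hG : 0 < Real.Gamma s * Real.pi ^ (-s) := by
    have := Real.Gamma_pos_of_pos hs
    positivity
  have hki : ∀ ξ : EuclideanSpace ℝ (Fin N), ξ ≠ 0 → IntegrableOn (k ξ) (Set.Ioi 0) := by
    intro ξ hξ
    -- A nonintegrable function has Bochner integral `0`, whereas the integral was found to be
    -- positive.
    by_contra hcon
    have := hkI ξ hξ
    rw [integral_undef hcon] at this
    exact hG.ne this
  have hkm : Measurable (Function.uncurry k) := by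
    refine Measurable.mul (Measurable.mul (measurable_snd.pow_const _) ?_)
      ((measurable_norm.comp measurable_fst).pow_const _)
    exact (by fun_prop : Continuous fun z : EuclideanSpace ℝ (Fin N) × ℝ =>
      Real.exp (-(Real.pi * ‖z.1‖ ^ 2 * z.2))).measurable
  have hprod := integrable_uncurry_ofReal_mul (μ := volume)
    (ν := (volume.restrict (Set.Ioi (0 : ℝ)))) hkm
    (Filter.Eventually.of_forall fun ξ => by
      filter_upwards [ae_restrict_mem measurableSet_Ioi] with t (ht : 0 < t)
      simp only [hk, Pi.zero_apply]
      positivity) hV.aestronglyMeasurable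
    (by filter_upwards [hne] with ξ hξ using hki ξ hξ) (by
      refine (hV.norm.const_mul (Real.Gamma s * Real.pi ^ (-s))).congr ?_
      filter_upwards [hne] with ξ hξ
      rw [hkI ξ hξ])
  rw [← integral_integral_swap hprod, ← integral_const_mul]
  refine integral_congr_ae ?_
  filter_upwards [hne] with ξ hξ
  rw [integral_mul_const, integral_complex_ofReal, hkI ξ hξ]

lemma exp_neg_le_rpow {x k : ℝ} (hx : 0 < x) (hk : 0 < k) : Real.exp (-x) ≤ (k / x) ^ k := by
  have h1 : x / k ≤ Real.exp (x / k) := by linarith [Real.add_one_le_exp (x / k)]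
  have h2 : (x / k) ^ k ≤ Real.exp x := by
    calc (x / k) ^ k ≤ Real.exp (x / k) ^ k := Real.rpow_le_rpow (by positivity) h1 hk.le
      _ = Real.exp x := by rw [← Real.exp_mul]; congr 1; field_simp
  rw [Real.exp_neg, show k / x = (x / k)⁻¹ by rw [inv_div], Real.inv_rpow (by positivity)]
  exact inv_anti₀ (by positivity) h2

/-- Superposition of Gaussians is dominated by the Riesz kernel. -/
lemma lintegral_rpow_mul_gaussian_le {k s : ℝ} (hs : 0 < s) (hsk : s < k) :
    ∃ C : ℝ≥0, ∀ z : ℝ, 0 < z →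
      ∫⁻ t in Set.Ioi (0 : ℝ), ENNReal.ofReal (t ^ (s - 1) *
        (t ^ (-k) * Real.exp (-(Real.pi / t) * z ^ 2))) ≤ C * ENNReal.ofReal (z ^ (2 * s - 2 * k)) := by
  have hk : 0 < k := hs.trans hsk
  refine ⟨Real.toNNReal ((k / Real.pi) ^ k / s + 1 / (k - s)), fun z hz => ?_⟩
  -- The `t`-integral is cut at `t = z^2`: below, the exponential compensates `t^(-k)` and leaves a
  -- multiple of `ρ^(-k)`; above, the exponential is at most `1` and `t^(s - k - 1)` is integrable
  -- because `s < k`.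
  set ρ : ℝ := z ^ 2 with hρ
  have hρ0 : 0 < ρ := by positivity
  rw [← Set.Ioc_union_Ioi_eq_Ioi hρ0.le, lintegral_union measurableSet_Ioi Set.Ioc_disjoint_Ioi_same]
  have e1 : ∫⁻ t in Set.Ioc 0 ρ, ENNReal.ofReal (t ^ (s - 1) *
        (t ^ (-k) * Real.exp (-(Real.pi / t) * ρ))) ≤
      ENNReal.ofReal ((k / Real.pi) ^ k / s * ρ ^ (s - k)) := by
    calc _ ≤ ∫⁻ t in Set.Ioc 0 ρ, ENNReal.ofReal (t ^ (s - 1)) *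
          ENNReal.ofReal ((k / (Real.pi * ρ)) ^ k) := by
          refine setLIntegral_mono' measurableSet_Ioc fun t ht => ?_
          have ht0 := ht.1
          rw [← ENNReal.ofReal_mul (by positivity)]
          refine ENNReal.ofReal_le_ofReal (mul_le_mul_of_nonneg_left ?_ (by positivity))
          have := exp_neg_le_rpow (x := Real.pi / t * ρ) (by positivity) hk
          rw [neg_mul]
          calc _ ≤ t ^ (-k) * (k / (Real.pi / t * ρ)) ^ k := by gcongr
            _ = t ^ (-k) * (t * (k / (Real.pi * ρ))) ^ k := by congr 2; field_simp
            _ = _ := by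
              rw [Real.mul_rpow ht0.le (by positivity), ← mul_assoc, ← Real.rpow_add ht0]; simp
      _ = ENNReal.ofReal (ρ ^ s / s) * ENNReal.ofReal ((k / (Real.pi * ρ)) ^ k) := by
          rw [lintegral_mul_const _ (by fun_prop), lintegral_Ioc_rpow hs hρ0.le]
      _ = _ := by
          rw [← ENNReal.ofReal_mul (by positivity)]
          congr 1
          rw [← div_div, Real.div_rpow (by positivity) hρ0.le, Real.rpow_sub hρ0]
          field_simp
  have e2 : ∫⁻ t in Set.Ioi ρ, ENNReal.ofReal (t ^ (s - 1) *
        (t ^ (-k) * Real.exp (-(Real.pi / t) * ρ))) ≤ ENNReal.ofReal (1 / (k - s) * ρ ^ (s - k)) := by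
    calc _ ≤ ∫⁻ t in Set.Ioi ρ, ENNReal.ofReal (t ^ (-(k - s) - 1)) := by
          refine setLIntegral_mono' measurableSet_Ioi fun t (ht : ρ < t) => ENNReal.ofReal_le_ofReal ?_
          have ht0 : 0 < t := hρ0.trans ht
          calc _ ≤ t ^ (s - 1) * (t ^ (-k) * 1) := by
                gcongr
                rw [Real.exp_le_one_iff, neg_mul, neg_nonpos]
                positivity
            _ = _ := by rw [mul_one, ← Real.rpow_add ht0]; congr 1; ring
      _ = _ := by
          rw [lintegral_Ioi_rpow_neg (by linarith) hρ0, neg_sub]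
          congr 1; ring
  refine (add_le_add e1 e2).trans (le_of_eq ?_)
  have hks : 0 < k - s := by linarith
  have hzρ : z ^ (2 * s - 2 * k) = ρ ^ (s - k) := by
    rw [hρ, ← Real.rpow_natCast, ← Real.rpow_mul hz.le]; congr 1; push_cast; ring
  rw [← ENNReal.ofReal_add (by positivity) (by positivity), ← add_mul, hzρ,
    ENNReal.ofReal_mul (by positivity)]
  rfl

/-- By Tonelli's theorem the point `y` is counted at the scales `r > ‖y - x‖`, and the integral of
`r^(γ - N - 1)` over them is the Riesz kernel; convergence needs `γ < N`. -/
lemma scalePotential_eq_lintegral {N : ℕ} (hN : 0 < N) {γ : ℝ} (hγ : γ < N)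
    {f : EuclideanSpace ℝ (Fin N) → ℝ≥0∞} (hf : Measurable f) (x : EuclideanSpace ℝ (Fin N)) :
    scalePotential γ f x = ∫⁻ y, ENNReal.ofReal (‖y - x‖ ^ (γ - N) / (N - γ)) * f y := by
  have : Nonempty (Fin N) := ⟨⟨0, hN⟩⟩
  have hne : ∀ᵐ y : EuclideanSpace ℝ (Fin N), y ≠ x := by simp [ae_iff]
  have h1 : ∀ r : ℝ, ENNReal.ofReal (r ^ (γ - N - 1)) * ∫⁻ y in Metric.ball x r, f y =
      ∫⁻ y, {z : ℝ × EuclideanSpace ℝ (Fin N) | ‖z.2 - x‖ < z.1}.indicator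
        (fun z => ENNReal.ofReal (z.1 ^ (γ - N - 1)) * f z.2) (r, y) := by
    intro r
    rw [← lintegral_const_mul' _ _ ENNReal.ofReal_ne_top,
      ← lintegral_indicator Metric.isOpen_ball.measurableSet]
    rfl
  rw [scalePotential]
  simp_rw [h1]
  rw [lintegral_lintegral_swap]
  · refine lintegral_congr_ae ?_
    filter_upwards [hne] with y hy
    have hd : 0 < ‖y - x‖ := norm_pos_iff.2 (sub_ne_zero.2 hy)
    calc _ = ∫⁻ r in Set.Ioi (0 : ℝ), (Set.Ioi ‖y - x‖).indicator
          (fun r => ENNReal.ofReal (r ^ (γ - N - 1)) * f y) r := rfl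
      _ = ∫⁻ r in Set.Ioi ‖y - x‖, ENNReal.ofReal (r ^ (-(N - γ) - 1)) * f y := by
          rw [lintegral_indicator measurableSet_Ioi, Measure.restrict_restrict measurableSet_Ioi,
            Set.Ioi_inter_Ioi, max_eq_left hd.le, neg_sub]
      _ = _ := by
          rw [lintegral_mul_const _ (by fun_prop), lintegral_Ioi_rpow_neg (by linarith) hd, neg_sub]
  · refine Measurable.aemeasurable ?_
    refine Measurable.indicator ?_ (measurableSet_lt (by fun_prop) (by fun_prop))
    exact Measurable.mul (by fun_prop) (hf.comp measurable_snd)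

lemma measurable_fracLaplacian {N : ℕ} (s : ℝ) (u : SchwartzMap (EuclideanSpace ℝ (Fin N)) ℝ) :
    Measurable (fracLaplacian s u) := by
  have h : Measurable fun z : EuclideanSpace ℝ (Fin N) × EuclideanSpace ℝ (Fin N) =>
      (2 * u z.1 - u (z.1 + z.2) - u (z.1 - z.2)) / ‖z.2‖ ^ ((N : ℝ) + 2 * s) := by
    refine Measurable.div ?_ ((measurable_norm.comp measurable_snd).pow_const _)
    have := u.continuous
    exact (by fun_prop : Continuous fun z : EuclideanSpace ℝ (Fin N) × EuclideanSpace ℝ (Fin N) =>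
      2 * u z.1 - u (z.1 + z.2) - u (z.1 - z.2)).measurable
  exact (h.stronglyMeasurable.integral_prod_right (ν := volume)).measurable.const_mul _

lemma fracLaplacianConst_pos {N : ℕ} {s : ℝ} (hs0 : 0 < s) (hs1 : s < 1) :
    0 < fracLaplacianConst N s := by
  have h1 : 0 < Real.Gamma ((N : ℝ) / 2 + s) := Real.Gamma_pos_of_pos (by positivity)
  have h2 : 0 < Real.Gamma (1 - s) := Real.Gamma_pos_of_pos (by linarith)
  unfold fracLaplacianConst
  positivity

/-- Pointwise control of a Schwartz function by the potential of its fractional Laplacian. -/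
theorem SchwartzMap.enorm_le_scalePotential_fracLaplacian {N : ℕ} (hN : 0 < N) {s : ℝ}
    (hs0 : 0 < s) (hs1 : s < 1) (hsN : 2 * s < N) :
    ∃ B : ℝ≥0, ∀ (u : SchwartzMap (EuclideanSpace ℝ (Fin N)) ℝ) (x : EuclideanSpace ℝ (Fin N)),
      ‖u x‖ₑ ≤ B * scalePotential (2 * s) (fun y => ‖fracLaplacian s u y‖ₑ) x := by
  obtain ⟨c, hc0, hc⟩ := integral_one_sub_cos_div_norm_rpow hN hs0 hs1
  obtain ⟨C, hC⟩ := lintegral_rpow_mul_gaussian_le (k := (N : ℝ) / 2) hs0 (by linarith)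
  set A := fracLaplacianConst N s with hA
  have hA0 : 0 < A := fracLaplacianConst_pos hs0 hs1
  -- The symbol of the fractional Laplacian contributes `A * c`, the Gamma integral the rest. Only
  -- `D > 0` is used.
  set D := A * c * (Real.Gamma s * Real.pi ^ (-s)) with hD
  have hD0 : 0 < D := by
    have := Real.Gamma_pos_of_pos hs0
    positivity
  refine ⟨Real.toNNReal D⁻¹ * (C * Real.toNNReal (N - 2 * s)), fun u x => ?_⟩
  obtain ⟨W, hW⟩ := u.ofReal_eq_integral_character
  set f := fracLaplacian s u with hf
  have hfm : Measurable f := measurable_fracLaplacian s u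
  have hfW := fracLaplacian_eq_integral_character hN hs0 hs1 hc hW
  have hVi : Integrable fun ξ => ((A * c : ℝ) : ℂ) * (((‖ξ‖ ^ (2 * s) : ℝ) : ℂ) * W ξ) :=
    (W.integrable_norm_rpow_mul (by linarith) (by linarith)).const_mul _
  set G : ℝ → EuclideanSpace ℝ (Fin N) → ℝ := fun t y =>
    t ^ (-((N : ℝ) / 2)) * Real.exp (-(Real.pi / t) * ‖y - x‖ ^ 2) with hG
  have hχi : Integrable fun ξ =>
      Complex.exp (((2 * Real.pi * inner ℝ ξ x : ℝ) : ℂ) * Complex.I) * W ξ := by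
    refine W.integrable.bdd_mul (c := 1) (Continuous.aestronglyMeasurable (by fun_prop))
      (Filter.Eventually.of_forall fun ξ => (norm_character ξ x).le)
  -- The negative power of the Laplacian as an integral of the heat semigroup applied to `f`. It is
  -- checked on the Fourier side, where it reduces to the Gamma integral.
  have hrep : D * u x = ∫ t in Set.Ioi (0 : ℝ), t ^ (s - 1) * ∫ y, G t y * f y := by
    apply Complex.ofReal_injective
    rw [← integral_complex_ofReal, hD, Complex.ofReal_mul, Complex.ofReal_mul (A * c), hW x,
      mul_assoc, ← integral_rpow_mul_gaussian_symbol hN hs0 hχi, ← integral_const_mul]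
    refine setIntegral_congr_fun measurableSet_Ioi fun t (ht : 0 < t) => ?_
    rw [Complex.ofReal_mul (t ^ (s - 1)), integral_gaussian_mul_eq hVi hfW ht x, ← integral_const_mul,
      ← integral_const_mul]
    congr 1 with ξ
    push_cast
    ring
  have hux : ‖u x‖ₑ = ENNReal.ofReal D⁻¹ * ‖D * u x‖ₑ := by
    rw [enorm_mul, Real.enorm_of_nonneg hD0.le, ← mul_assoc, ← ENNReal.ofReal_mul (by positivity),
      inv_mul_cancel₀ hD0.ne']
    simp
  have hmain : ‖D * u x‖ₑ ≤ ∫⁻ y, ‖f y‖ₑ * (C * ENNReal.ofReal (‖y - x‖ ^ (2 * s - N))) := by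
    rw [hrep]
    refine (enorm_integral_le_lintegral_enorm _).trans ?_
    calc _ ≤ ∫⁻ t in Set.Ioi (0 : ℝ), ∫⁻ y, ‖f y‖ₑ * ENNReal.ofReal (t ^ (s - 1) * G t y) := by
          refine setLIntegral_mono' measurableSet_Ioi fun t (ht : 0 < t) => ?_
          rw [enorm_mul, Real.enorm_of_nonneg (by positivity)]
          refine (mul_le_mul' le_rfl (enorm_integral_le_lintegral_enorm _)).trans (le_of_eq ?_)
          rw [← lintegral_const_mul' _ _ ENNReal.ofReal_ne_top]
          congr 1 with y
          rw [enorm_mul, Real.enorm_of_nonneg (show 0 ≤ G t y by simp only [hG]; positivity),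
            ENNReal.ofReal_mul (p := t ^ (s - 1)) (q := G t y) (by positivity)]
          ring
      _ = ∫⁻ y, ∫⁻ t in Set.Ioi (0 : ℝ), ‖f y‖ₑ * ENNReal.ofReal (t ^ (s - 1) * G t y) := by
          rw [lintegral_lintegral_swap]
          refine Measurable.aemeasurable (Measurable.mul (hfm.enorm.comp measurable_snd) ?_)
          simp only [hG]
          fun_prop
      _ ≤ _ := by
          have : Nonempty (Fin N) := ⟨⟨0, hN⟩⟩
          have hne : ∀ᵐ y : EuclideanSpace ℝ (Fin N), y ≠ x := by simp [ae_iff]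
          refine lintegral_mono_ae ?_
          filter_upwards [hne] with y hy
          rw [lintegral_const_mul' _ _ enorm_ne_top]
          gcongr
          have := hC ‖y - x‖ (norm_pos_iff.2 (sub_ne_zero.2 hy))
          rwa [show 2 * ((N : ℝ) / 2) = N by ring] at this
  have hpot : ∫⁻ y, ‖f y‖ₑ * (C * ENNReal.ofReal (‖y - x‖ ^ (2 * s - N))) =
      (C * Real.toNNReal (N - 2 * s) : ℝ≥0) * scalePotential (2 * s) (fun y => ‖f y‖ₑ) x := by
    rw [scalePotential_eq_lintegral hN hsN hfm.enorm, ← lintegral_const_mul' _ _ ENNReal.coe_ne_top]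
    congr 1 with y
    have h0 : 0 < N - 2 * s := by linarith
    have h1 : ENNReal.ofReal (‖y - x‖ ^ (2 * s - N)) = ENNReal.ofReal (N - 2 * s) *
        ENNReal.ofReal (‖y - x‖ ^ (2 * s - N) / (N - 2 * s)) := by
      rw [← ENNReal.ofReal_mul h0.le]
      congr 1
      field_simp
    rw [h1]
    push_cast
    simp only [ENNReal.ofReal]
    ring
  rw [hux]
  refine (mul_le_mul' le_rfl (hmain.trans hpot.le)).trans (le_of_eq ?_)
  rw [← mul_assoc]
  rfl

/-! ### The Hardy–Sobolev inequalities -/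

theorem hardySobolev_gradient {N : ℕ} {α β p q lam : ℝ} (h : HardySobolevAdmissible N 1 α β p q lam) :
    ∃ C : ℝ≥0, 0 < C ∧
      ∀ (u : EuclideanSpace ℝ (Fin N) → ℝ)
        (G : EuclideanSpace ℝ (Fin N) → EuclideanSpace ℝ (Fin N)),
        IsWeakGradient u G → MemMorrey p lam (fun x => ‖x‖ ^ α * u x) →
        morreyNorm q lam (fun x => u x / ‖x‖ ^ β) ≤
          C * morreyNorm p lam (fun x => ‖x‖ ^ α • G x) := by
  obtain ⟨B, hB⟩ := IsWeakGradient.enorm_le_scalePotential (N := N)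
  obtain ⟨C, hC0, hC⟩ := hardySobolev_of_le_scalePotential one_pos h B
  refine ⟨C, hC0, fun u G hG hu => ?_⟩
  refine hC u G _ _ hG.locallyIntegrable_grad.aestronglyMeasurable (hB one_pos h hG hu)
    (fun x => ?_) (fun x => ?_)
  · rw [div_eq_mul_inv, ← Real.rpow_neg (norm_nonneg _), enorm_mul, mul_comm,
      Real.enorm_of_nonneg (by positivity)]
  · rw [enorm_smul, Real.enorm_of_nonneg (by positivity)]

theorem hardySobolev_fracLaplacian {N : ℕ} {γ α β p q lam : ℝ} (hγ0 : 0 < γ) (hγ1 : γ < 1)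
    (h : HardySobolevAdmissible N γ α β p q lam) :
    ∃ C : ℝ≥0, 0 < C ∧
      ∀ u : SchwartzMap (EuclideanSpace ℝ (Fin N)) ℝ,
        morreyNorm q lam (fun x => ‖x‖ ^ (-β) * u x) ≤
          C * morreyNorm p lam (fun x => ‖x‖ ^ α * fracLaplacian (γ / 2) u x) := by
  obtain ⟨hN, -⟩ := h.exponents hγ0
  obtain ⟨B, hB⟩ := SchwartzMap.enorm_le_scalePotential_fracLaplacian hN (s := γ / 2) (by linarith)
    (by linarith) (by linarith [h.order_lt])
  rw [mul_div_cancel₀ γ two_ne_zero] at hB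
  obtain ⟨C, hC0, hC⟩ := hardySobolev_of_le_scalePotential hγ0 h B
  refine ⟨C, hC0, fun u => ?_⟩
  refine hC u (fracLaplacian (γ / 2) u) _ _ (measurable_fracLaplacian _ u).aestronglyMeasurable
    (Filter.Eventually.of_forall (hB u)) (fun x => ?_) (fun x => ?_)
  all_goals rw [enorm_mul, Real.enorm_of_nonneg (by positivity)]

theorem theorem5p11 (N : ℕ) :
    -- weighted integer Hardy-Sobolev inequality
    (∀ α β p q lam : ℝ, HardySobolevAdmissible N 1 α β p q lam →
      ∃ C : ℝ≥0, 0 < C ∧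
        ∀ (u : EuclideanSpace ℝ (Fin N) → ℝ)
          (G : EuclideanSpace ℝ (Fin N) → EuclideanSpace ℝ (Fin N)),
          IsWeakGradient u G → MemMorrey p lam (fun x => ‖x‖ ^ α * u x) →
          morreyNorm q lam (fun x => u x / ‖x‖ ^ β) ≤
            C * morreyNorm p lam (fun x => ‖x‖ ^ α • G x)) ∧
    -- the case `α = 0`
    (∀ β p q lam : ℝ, HardySobolevAdmissible N 1 0 β p q lam →
      ∃ C : ℝ≥0, 0 < C ∧
        ∀ (u : EuclideanSpace ℝ (Fin N) → ℝ)
          (G : EuclideanSpace ℝ (Fin N) → EuclideanSpace ℝ (Fin N)),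
          IsWeakGradient u G → MemMorrey p lam u →
          morreyNorm q lam (fun x => u x / ‖x‖ ^ β) ≤ C * morreyNorm p lam G) ∧
    -- weighted fractional Hardy-Sobolev inequality
    (∀ γ α β p q lam : ℝ, 0 < γ → γ < 1 → HardySobolevAdmissible N γ α β p q lam →
      ∃ C : ℝ≥0, 0 < C ∧
        ∀ u : SchwartzMap (EuclideanSpace ℝ (Fin N)) ℝ,
          morreyNorm q lam (fun x => ‖x‖ ^ (-β) * u x) ≤
            C * morreyNorm p lam (fun x => ‖x‖ ^ α * fracLaplacian (γ / 2) u x)) ∧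
    -- the case `α = 0`
    (∀ γ β p q lam : ℝ, 0 < γ → γ < 1 → HardySobolevAdmissible N γ 0 β p q lam →
      ∃ C : ℝ≥0, 0 < C ∧
        ∀ u : SchwartzMap (EuclideanSpace ℝ (Fin N)) ℝ,
          morreyNorm q lam (fun x => ‖x‖ ^ (-β) * u x) ≤
            C * morreyNorm p lam (fracLaplacian (γ / 2) u)) := by
  refine ⟨fun α β p q lam h => hardySobolev_gradient h, fun β p q lam h => ?_,
    fun γ α β p q lam h0 h1 h => hardySobolev_fracLaplacian h0 h1 h, fun γ β p q lam h0 h1 h => ?_⟩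
  · simpa only [Real.rpow_zero, one_mul, one_smul] using hardySobolev_gradient h
  · simpa only [Real.rpow_zero, one_mul] using hardySobolev_fracLaplacian h0 h1 h
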